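/- Let $\mathcal X\subseteq\mathbb R^N$ be a linear subspace with the Euclidean inner product and norm, and let $U$, $\mathcal S$, $\mathcal D$, $c_{\mathcal S}$ satisfy the following. (a) $U:\mathcal X\to\mathbb R$ is strictly convex, positive definite ($U(\mathbf 0)=0$ and $U(\mathbf x)>0$ for $\mathbf x\neq\mathbf 0$), differentiable everywhere with continuous gradient $\nabla U:\mathcal X\to\mathcal X$, and homogeneous of degree $3/2$, i.e. $U(\lambda\mathbf x)=\lambda^{3/2}U(\mathbf x)$ for all $\lambda>0$. (b) $\mathcal S:\mathcal X\rightrightarrows\mathcal X$ is a set-valued map with nonempty, bounded, closed, convex values, upper semi-continuous, homogeneous of degree $0$ ($\mathcal S(\lambda\mathbf x)=\mathcal S(\mathbf x)$ for all $\lambda>0$), and $c_{\mathcal S}>0$ is such that $\langle\mathbf s,\mathbf e_0\rangle\ge c_{\mathcal S}\|\mathbf e_0\|$ for all $\mathbf e_0\in\mathcal X$ and $\mathbf s\in\mathcal S(\mathbf e_0)$. (c) $\mathcal D\subset\mathcal X$ is compact with $\sup_{\mathbf d\in\mathcal D}\|\mathbf d\|=1$. Let $L>0$, $\gamma\ge 0$,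 $k_0,k_1>0$ and $\beta\ge 7$. Consider on $\mathcal X\times\mathcal X$ the differential inclusion $$\dot{\mathbf e}_0=-k_0L^{1/2}\nabla U(\mathbf e_0)+\mathbf e_1-\gamma\mathbf e_0,\qquad \dot{\mathbf e}_1\in-k_1L\,\mathcal S(\mathbf e_0)-\gamma\mathbf e_1+L\,\mathcal D .$$ Let $U^*(\mathbf x_1)=\sup_{\mathbf x_0\in\mathcal X}\{\langle\mathbf x_0,\mathbf x_1\rangle-U(\mathbf x_0)\}$ be the convex conjugate of $U$ and, for $\mathbf x=(\mathbf x_0,\mathbf x_1)\in\mathcal X\times\mathcal X$, put $$\Gamma(\mathbf x)=\|\nabla U(\mathbf x_0)-\mathbf x_1\|^2,\qquad \Pi(\mathbf x)=\sup_{\mathbf s\in\mathcal S(\mathbf x_0),\ \mathbf d\in\mathcal D}\Big\langle(1+\beta)\nabla U^*(\mathbf x_1)-\mathbf x_0,\ -\tfrac{k_1}{k_0}\Big(\mathbf s-\tfrac1{k_1}\mathbf d\Big)\Big\rangle,$$ $$\|\mathbf x\|_{\mathbf r}=\sum_{i=1}^N|x_{0,i}|^{1/2}+\sum_{i=1}^N|x_{1,i}|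 .$$ If $$k_0>\sup_{\|\mathbf x\|_{\mathbf r}=1,\ \Gamma(\mathbf x)>0}\frac{\Pi(\mathbf x)}{\Gamma(\mathbf x)}\qquad\text{and}\qquad k_1>\frac1{c_{\mathcal S}},$$ then the origin is globally finite-time stable. That is, calling solutions the locally absolutely continuous curves in $\mathcal X\times\mathcal X$ that satisfy the inclusion for almost every time: a solution on $[0,\infty)$ exists from every initial state, and every solution on an interval $[0,\tau)$ with $0<\tau<\infty$ can be continued to $[0,\infty)$; the origin is Lyapunov stable; and for every initial state $(\mathbf e_0(0),\mathbf e_1(0))\in\mathcal X\times\mathcal X$ there is a finite $T\ge0$ such that every solution on $[0,\infty)$ starting there vanishes for all $t\ge T$. -/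

import Mathlib

open Set Filter Topology MeasureTheory

noncomputable section

namespace AbstractSuperTwisting

section DifferentialInclusion

variable {E : Type*} [NormedAddCommGroup E] [NormedSpace ℝ E]

/-- `z` is a (Caratheodory / Filippov) solution of the differential inclusion `z' ∈ F z` on the
time interval `J`: it is absolutely continuous on every compact subinterval of `J`, and at almost
every time of `J` its derivative exists and belongs to `F (z t)`. -/
def IsSolutionOn (F : E → Set E) (J : Set ℝ) (z : ℝ → E) : Prop :=
  (∀ a ∈ J, ∀ b ∈ J, AbsolutelyContinuousOnInterval z a b) ∧
    ∀ᵐ t : ℝ, t ∈ J → ∃ v ∈ F (z t), HasDerivAt z v t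

/-- The origin of `z' ∈ F z` is globally finite-time stable: solutions exist from every initial
state and all of them can be continued to `[0, ∞)`, the origin is Lyapunov stable, and for every
initial state there is a finite time from which on every solution starting there is zero. -/
structure GloballyFiniteTimeStable (F : E → Set E) : Prop where
  exists_solution : ∀ z₀ : E, ∃ z : ℝ → E, IsSolutionOn F (Ici 0) z ∧ z 0 = z₀
  continuation : ∀ τ : ℝ, 0 < τ → ∀ z : ℝ → E, IsSolutionOn F (Ico 0 τ) z →
    ∃ w : ℝ → E, IsSolutionOn F (Ici 0) w ∧ EqOn w z (Ico 0 τ)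
  stable : ∀ ε : ℝ, 0 < ε → ∃ δ : ℝ, 0 < δ ∧ ∀ z : ℝ → E, IsSolutionOn F (Ici 0) z →
    ‖z 0‖ < δ → ∀ t : ℝ, 0 ≤ t → ‖z t‖ < ε
  finite_time : ∀ z₀ : E, ∃ T : ℝ, 0 ≤ T ∧ ∀ z : ℝ → E, IsSolutionOn F (Ici 0) z →
    z 0 = z₀ → ∀ t : ℝ, T ≤ t → z t = 0

end DifferentialInclusion

variable {N : ℕ} {X : Submodule ℝ (EuclideanSpace ℝ (Fin N))}

/-- The standing assumption on the potential `U`, the set-valued map `S`, the disturbance set `D`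
and the constant `cS`, on a linear subspace `X` of `ℝ^N`. The subdifferential of `U` is the
singleton `{∇U}`: it is automatically nonempty, bounded, closed and convex, and its upper
semi-continuity is the continuity of the gradient. -/
structure BasicAssumption (U : X → ℝ) (S : X → Set X) (D : Set X) (cS : ℝ) : Prop where
  U_strictConvex : StrictConvexOn ℝ univ U
  U_zero : U 0 = 0
  U_pos : ∀ x : X, x ≠ 0 → 0 < U x
  U_differentiable : Differentiable ℝ U
  U_homogeneous : ∀ (lam : ℝ) (x : X), 0 < lam → U (lam • x) = lam ^ (3 / 2 : ℝ) * U x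
  gradient_U_continuous : Continuous (gradient U)
  cS_pos : 0 < cS
  S_inner : ∀ e : X, ∀ s ∈ S e, cS * ‖e‖ ≤ inner ℝ s e
  S_homogeneous : ∀ (lam : ℝ) (x : X), 0 < lam → S (lam • x) = S x
  S_nonempty : ∀ x : X, (S x).Nonempty
  S_bounded : ∀ x : X, Bornology.IsBounded (S x)
  S_closed : ∀ x : X, IsClosed (S x)
  S_convex : ∀ x : X, Convex ℝ (S x)
  S_upperSemicontinuous : UpperHemicontinuous S
  D_compact : IsCompact D
  D_sup_norm : IsLUB ((fun d : X => ‖d‖) '' D) 1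

/-- The right-hand side of the abstract super-twisting system with state `(e₀, e₁)` in `X × X`:
`e₀' = -k₀ L^{1/2} ∇U(e₀) + e₁ - γ e₀`, `e₁' ∈ -k₁ L S(e₀) - γ e₁ + L D`. -/
def superTwisting (U : X → ℝ) (S : X → Set X) (D : Set X) (L γ k₀ k₁ : ℝ) (e : X × X) :
    Set (X × X) :=
  {v | v.1 = -(k₀ * Real.sqrt L) • gradient U e.1 + e.2 - γ • e.1 ∧
    ∃ s ∈ S e.1, ∃ d ∈ D, v.2 = -(k₁ * L) • s - γ • e.2 + L • d}

/-- The convex conjugate of `U` over `X`. -/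
def conjugate (U : X → ℝ) (x₁ : X) : ℝ :=
  ⨆ x₀ : X, (inner ℝ x₀ x₁ - U x₀)

/-- The homogeneous norm `∑ i, |x i| ^ (1 / r i)` of `x = (x₀, x₁)` for the weights
`r = (2, ..., 2, 1, ..., 1)`. -/
def homNorm (x : X × X) : ℝ :=
  ∑ i : Fin N, |(x.1 : EuclideanSpace ℝ (Fin N)) i| ^ (1 / 2 : ℝ) +
    ∑ i : Fin N, |(x.2 : EuclideanSpace ℝ (Fin N)) i|

/-- `Γ(x) = ‖∇U(x₀) - x₁‖²`. -/
def Gam (U : X → ℝ) (x : X × X) : ℝ :=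
  ‖gradient U x.1 - x.2‖ ^ 2

/-- `Π(x)`: the supremum over `d ∈ D` and `s ∈ S(x₀)` of
`⟨(1 + β) ∇U*(x₁) - x₀, -(k₁/k₀) (s - d / k₁)⟩`. -/
def Pie (U : X → ℝ) (S : X → Set X) (D : Set X) (β k₀ k₁ : ℝ) (x : X × X) : ℝ :=
  sSup {p : ℝ | ∃ s ∈ S x.1, ∃ d ∈ D,
    p = inner ℝ ((1 + β) • gradient (conjugate U) x.2 - x.1)
      (-(k₁ / k₀) • (s - (1 / k₁) • d))}

end AbstractSuperTwisting

end

/-!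
In the coordinates `x₀ = e₀`, `x₁ = e₁ / κ` with `κ = k₀ √L`, a strict Lyapunov function is
`V x = U x₀ - ⟨x₀, x₁⟩ + (1 + β) U* x₁`, the Fenchel gap of `U` plus `β U*`. It is positive definite
by the Fenchel-Young inequality, it is `C¹` because `gradient U` is a homeomorphism of `X` whose
inverse is the gradient of the conjugate `U*`, and its partial gradients are `∇U x₀ - x₁` and
`(1 + β) ∇U* x₁ - x₀`. Along a solution, up to the factor `κ`, its derivative is therefore at most
`-Γ + Π / k₀` plus the contribution of the damping `γ`, which has the good sign
(`IsPotential.damping_nonneg`).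

Everything is homogeneous for the dilations `(μ² x₀, μ x₁)`: `V` has degree `3`, and `Γ` and `Π` have
degree `2`. The condition on `k₀` makes the derivative negative on the part of the unit sphere where
`Γ > 0`, and the condition on `k₁` makes it negative where `Γ = 0`
(`BasicAssumption.decayRate_neg`). Since the graph of `S` over the sphere is compact, homogeneity
turns this into `V' ≤ -c V ^ (2 / 3)` (`IsPotential.exists_decayRate_le`), so that `V ^ (1 / 3)`
reaches zero linearly in time (`eq_zero_of_hasDerivAt_le_neg_rpow`). For solutions that are merely
absolutely continuous the differential inequality holds almost everywhere and is integrated by the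
fundamental theorem of calculus for absolutely continuous functions.

Solutions exist because the right-hand side, with the disturbance frozen at one element of `D`, is
upper hemicontinuous of linear growth with convex closed values: ultrafilter limits of Euler step
functions are solutions (`exists_isSolutionOn_Ici`). A solution on `[0, τ)` stays in a sublevel set
of `V`, hence is Lipschitz and can be continued past `τ` (`IsSolutionOn.exists_continuation`).
-/

namespace AbstractSuperTwisting

/-! ### Absolutely continuous curves -/

section AbsolutelyContinuous

theorem absolutelyContinuousOnInterval_comp {Y Z : Type*} [PseudoMetricSpace Y]
    [PseudoMetricSpace Z] {K : NNReal} {φ : Y → Z} {s : Set Y} {z : ℝ → Y} {a b : ℝ}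
    (hφ : LipschitzOnWith K φ s) (hz : AbsolutelyContinuousOnInterval z a b)
    (hm : MapsTo z (uIcc a b) s) : AbsolutelyContinuousOnInterval (fun t => φ (z t)) a b := by
  rw [absolutelyContinuousOnInterval_iff] at hz ⊢
  intro ε hε
  obtain ⟨δ, hδ, h⟩ := hz (ε / (K + 1)) (by positivity)
  refine ⟨δ, hδ, fun I hI hlt => ?_⟩
  have h1 := h I hI hlt
  calc ∑ i ∈ Finset.range I.1, dist (φ (z (I.2 i).1)) (φ (z (I.2 i).2))
      ≤ ∑ i ∈ Finset.range I.1, K * dist (z (I.2 i).1) (z (I.2 i).2) := by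
        refine Finset.sum_le_sum fun i hi => ?_
        obtain ⟨h2, h3⟩ := hI.1 i hi
        exact hφ.dist_le_mul _ (hm h2) _ (hm h3)
    _ = K * ∑ i ∈ Finset.range I.1, dist (z (I.2 i).1) (z (I.2 i).2) := by
        rw [Finset.mul_sum]
    _ ≤ K * (ε / (K + 1)) := by gcongr
    _ < (K + 1) * (ε / (K + 1)) := by
        have : 0 < ε / ((K : ℝ) + 1) := by positivity
        nlinarith
    _ = ε := by field_simp

theorem sub_le_of_ae_hasDerivAt_le {f : ℝ → ℝ} {a b c : ℝ} (hab : a ≤ b)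
    (hf : AbsolutelyContinuousOnInterval f a b)
    (h : ∀ᵐ t : ℝ, t ∈ Icc a b → ∃ v ≤ c, HasDerivAt f v t) : f b - f a ≤ c * (b - a) := by
  rw [← hf.integral_deriv_eq_sub]
  have h2 : ∫ _ in a..b, c = c * (b - a) := by simp [mul_comm]
  rw [← h2]
  refine intervalIntegral.integral_mono_ae_restrict hab hf.intervalIntegrable_deriv (by simp) ?_
  rw [Filter.EventuallyLE, ae_restrict_iff' measurableSet_Icc]
  filter_upwards [h] with t ht hm
  obtain ⟨v, hv, hd⟩ := ht hm
  rwa [hd.deriv]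

variable {E : Type*} [NormedAddCommGroup E] [NormedSpace ℝ E]

theorem norm_sub_le_of_ae_hasDerivAt {z : ℝ → E} {a b K : ℝ} (hab : a ≤ b)
    (hz : AbsolutelyContinuousOnInterval z a b)
    (h : ∀ᵐ t : ℝ, t ∈ Icc a b → ∃ v, ‖v‖ ≤ K ∧ HasDerivAt z v t) :
    ‖z b - z a‖ ≤ K * (b - a) := by
  obtain ⟨g, hg, hgz⟩ := exists_dual_vector'' ℝ (z b - z a)
  have hac : AbsolutelyContinuousOnInterval (fun t => g (z t)) a b :=
    absolutelyContinuousOnInterval_comp (g.lipschitz.lipschitzOnWith (s := univ)) hz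
      (mapsTo_univ _ _)
  have := sub_le_of_ae_hasDerivAt_le (c := K) hab hac (by
    filter_upwards [h] with t ht hm
    obtain ⟨v, hv, hd⟩ := ht hm
    refine ⟨g v, ?_, g.hasFDerivAt.comp_hasDerivAt t hd⟩
    calc g v ≤ ‖g v‖ := le_abs_self _
      _ ≤ ‖g‖ * ‖v‖ := g.le_opNorm v
      _ ≤ 1 * ‖v‖ := by gcongr
      _ ≤ K := by simpa using hv)
  rw [← map_sub, hgz] at this
  simpa using this

theorem absolutelyContinuousOnInterval_of_norm_sub_le {E : Type*}
    [SeminormedAddCommGroup E] {z : ℝ → E} {a b K : ℝ}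
    (h : ∀ s t, min a b ≤ s → s ≤ t → t ≤ max a b → ‖z t - z s‖ ≤ K * (t - s)) :
    AbsolutelyContinuousOnInterval z a b := by
  refine (LipschitzOnWith.of_dist_le_mul (K := K.toNNReal) ?_).absolutelyContinuousOnInterval
  have key : ∀ s ∈ uIcc a b, ∀ t ∈ uIcc a b, s ≤ t → dist (z s) (z t) ≤ K.toNNReal * dist s t := by
    intro s hs t ht hst
    rw [dist_comm, dist_eq_norm, dist_comm, Real.dist_eq, abs_of_nonneg (sub_nonneg.2 hst)]
    refine (h s t hs.1 hst ht.2).trans ?_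
    gcongr
    exact Real.le_coe_toNNReal K
  intro s hs t ht
  rcases le_total s t with hst | hst
  · exact key s hs t ht hst
  · rw [dist_comm, dist_comm s]
    exact key t ht s hs hst

end AbsolutelyContinuous

/-! ### Existence of solutions of differential inclusions -/

section Existence

variable {E : Type*} [NormedAddCommGroup E] [NormedSpace ℝ E]

/-- The Euler iterates with step `h` of the (possibly discontinuous) vector field `f`, started at
`z₀`. -/
def eulerSeq (f : E → E) (h : ℝ) (z₀ : E) : ℕ → E
  | 0 => z₀
  | k + 1 => eulerSeq f h z₀ k + h • f (eulerSeq f h z₀ k)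

/-- Discrete Gronwall bound for the Euler iterates of a vector field of linear growth. -/
theorem one_add_norm_eulerSeq_le {f : E → E} {C h : ℝ} (hC : 0 ≤ C) (hh : 0 ≤ h)
    (hf : ∀ x, ‖f x‖ ≤ C * (1 + ‖x‖)) (z₀ : E) (k : ℕ) :
    1 + ‖eulerSeq f h z₀ k‖ ≤ (1 + ‖z₀‖) * Real.exp (C * (k * h)) := by
  induction k with
  | zero => simp [eulerSeq]
  | succ k ih =>
    set y := eulerSeq f h z₀ k with hy
    have h1 : ‖y + h • f y‖ ≤ ‖y‖ + h * (C * (1 + ‖y‖)) := by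
      refine (norm_add_le _ _).trans ?_
      rw [norm_smul, Real.norm_of_nonneg hh]
      gcongr
      exact hf y
    have h2 : 1 + C * h ≤ Real.exp (C * h) := by
      rw [add_comm]; exact Real.add_one_le_exp _
    calc 1 + ‖eulerSeq f h z₀ (k + 1)‖ = 1 + ‖y + h • f y‖ := rfl
      _ ≤ (1 + ‖y‖) * (1 + C * h) := by linarith
      _ ≤ ((1 + ‖z₀‖) * Real.exp (C * (k * h))) * Real.exp (C * h) := by gcongr
      _ = (1 + ‖z₀‖) * Real.exp (C * ((k + 1 : ℕ) * h)) := by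
        rw [mul_assoc, ← Real.exp_add]; push_cast; ring_nf

/-- A difference quotient of the Euler iterates is an average of values of the vector field. -/
theorem inv_smul_eulerSeq_sub_mem {f : E → E} {h : ℝ} (hh : 0 < h) {z₀ : E} {K : Set E}
    (hK : Convex ℝ K) {m l : ℕ} (hml : m < l)
    (hf : ∀ k, m ≤ k → k < l → f (eulerSeq f h z₀ k) ∈ K) :
    (((l : ℝ) - m) * h)⁻¹ • (eulerSeq f h z₀ l - eulerSeq f h z₀ m) ∈ K := by
  have hlm : (0 : ℝ) < (l : ℝ) - m := sub_pos.2 (by exact_mod_cast hml)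
  have hsum : eulerSeq f h z₀ l - eulerSeq f h z₀ m =
      ∑ k ∈ Finset.Ico m l, h • f (eulerSeq f h z₀ k) := by
    rw [← Finset.sum_Ico_sub _ hml.le]
    refine Finset.sum_congr rfl fun k _ => ?_
    simp [eulerSeq]
  rw [hsum, Finset.smul_sum]
  have : ∀ k ∈ Finset.Ico m l, (((l : ℝ) - m) * h)⁻¹ • h • f (eulerSeq f h z₀ k) =
      ((l : ℝ) - m)⁻¹ • f (eulerSeq f h z₀ k) := by
    intro k _
    rw [smul_smul]; congr 1; field_simp
  rw [Finset.sum_congr rfl this]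
  refine hK.sum_mem (fun _ _ => by positivity) ?_ fun k hk => ?_
  · rw [Finset.sum_const, Nat.card_Ico, nsmul_eq_mul, Nat.cast_sub hml.le]
    field_simp
  · rw [Finset.mem_Ico] at hk
    exact hf k hk.1 hk.2

theorem norm_eulerSeq_sub_le {f : E → E} {h : ℝ} (hh : 0 < h) {z₀ : E} {M : ℝ}
    {m l : ℕ} (hml : m ≤ l) (hf : ∀ k, m ≤ k → k < l → ‖f (eulerSeq f h z₀ k)‖ ≤ M) :
    ‖eulerSeq f h z₀ l - eulerSeq f h z₀ m‖ ≤ M * (((l : ℝ) - m) * h) := by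
  rcases hml.eq_or_lt with rfl | hlt
  · simp
  have hlm : (0 : ℝ) < ((l : ℝ) - m) * h :=
    mul_pos (sub_pos.2 (by exact_mod_cast hlt)) hh
  have := inv_smul_eulerSeq_sub_mem hh (convex_closedBall (0 : E) M) hlt
    (fun k h1 h2 => by simpa using hf k h1 h2)
  rw [mem_closedBall_zero_iff, norm_smul, Real.norm_of_nonneg (by positivity),
    inv_mul_le_iff₀ hlm] at this
  linarith

/-- A differential inclusion whose right-hand side is upper hemicontinuous, of linear growth, with
nonempty closed convex values, has a locally Lipschitz solution on `[0, ∞)` from every initial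
state. The solution is the pointwise limit, along a nonprincipal ultrafilter, of Euler step
functions: its difference quotients are limits of averages of values of the right-hand side at
nearby states. -/
theorem exists_isSolutionOn_Ici [FiniteDimensional ℝ E] {F : E → Set E} {C : ℝ} (hC : 0 ≤ C)
    (hne : ∀ x, (F x).Nonempty) (hcl : ∀ x, IsClosed (F x)) (hcv : ∀ x, Convex ℝ (F x))
    (hF : UpperHemicontinuous F) (hgr : ∀ x, ∀ v ∈ F x, ‖v‖ ≤ C * (1 + ‖x‖)) (z₀ : E) :
    ∃ z : ℝ → E, IsSolutionOn F (Ici 0) z ∧ z 0 = z₀ := by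
  have : ProperSpace E := FiniteDimensional.proper ℝ E
  choose f hf using hne
  have hfgr : ∀ x, ‖f x‖ ≤ C * (1 + ‖x‖) := fun x => hgr x _ (hf x)
  set h : ℕ → ℝ := fun n => ((n : ℝ) + 1)⁻¹ with hh_def
  have hh : ∀ n, 0 < h n := fun n => by simp only [hh_def]; positivity
  set Y : ℕ → ℕ → E := fun n => eulerSeq f (h n) z₀ with hY
  set κ : ℕ → ℝ → ℕ := fun n t => ⌊t * ((n : ℝ) + 1)⌋₊ with hκ
  have hκmono : ∀ n, Monotone (κ n) := fun n s t hst => by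
    simp only [hκ]; gcongr
  have hκle : ∀ n t, 0 ≤ t → (κ n t) * h n ≤ t := fun n t ht => by
    simp only [hκ, hh_def]
    rw [← div_eq_mul_inv, div_le_iff₀ (by positivity)]
    exact Nat.floor_le (by positivity)
  have hκlim : ∀ t, 0 ≤ t → Tendsto (fun n => (κ n t : ℝ) * h n) atTop (𝓝 t) := fun t ht => by
    have h1 := (tendsto_nat_floor_mul_div_atTop (R := ℝ) ht).comp
      (tendsto_natCast_atTop_atTop.atTop_add (tendsto_const_nhds (x := (1 : ℝ))))
    simpa [hκ, hh_def, Function.comp_def, div_eq_mul_inv] using h1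
  set R : ℝ → ℝ := fun T => (1 + ‖z₀‖) * Real.exp (C * T) with hR
  have hYR : ∀ T, 0 ≤ T → ∀ n k, k ≤ κ n T → 1 + ‖Y n k‖ ≤ R T := fun T hT n k hk => by
    refine (one_add_norm_eulerSeq_le hC (hh n).le hfgr z₀ k).trans ?_
    simp only [hR]
    have : (k : ℝ) * h n ≤ T := by
      refine le_trans ?_ (hκle n T hT)
      have := (hh n).le
      gcongr
    gcongr
  have hfR : ∀ T, 0 ≤ T → ∀ n k, k ≤ κ n T → ‖f (Y n k)‖ ≤ C * R T := fun T hT n k hk =>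
    (hfgr _).trans (by gcongr; exact hYR T hT n k hk)
  set u : Ultrafilter ℕ := hyperfilter ℕ
  have hu : (u : Filter ℕ) ≤ atTop := Nat.hyperfilter_le_atTop
  -- the approximations are locally bounded, so they converge along the ultrafilter at every time
  have hlim : ∀ t, ∃ y, Tendsto (fun n => Y n (κ n t)) u (𝓝 y) := fun t => by
    have hmem : ∀ n, Y n (κ n t) ∈ Metric.closedBall (0 : E) (R (max t 0)) := fun n => by
      have := hYR (max t 0) (le_max_right _ _) n (κ n t) (hκmono n (le_max_left _ _))
      rw [mem_closedBall_zero_iff]; linarith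
    obtain ⟨y, -, hy⟩ := (isCompact_closedBall (0 : E) (R (max t 0))).ultrafilter_le_nhds
      (u.map fun n => Y n (κ n t)) (by
        rw [le_principal_iff]
        exact Filter.mem_map.2 (Filter.univ_mem' hmem))
    exact ⟨y, hy⟩
  choose z hz using hlim
  have hz0 : z 0 = z₀ := by
    refine tendsto_nhds_unique (hz 0) ?_
    simp [hκ, hY, eulerSeq]
  have hlip : ∀ T, ∀ s t, 0 ≤ s → s ≤ t → t ≤ T → ‖z t - z s‖ ≤ C * R T * (t - s) := by
    intro T s t hs hst htT
    refine le_of_tendsto_of_tendsto ((hz t).sub (hz s)).norm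
      ((((hκlim t (hs.trans hst)).sub (hκlim s hs)).const_mul (C * R T)).mono_left hu)
      (Eventually.of_forall fun n => ?_)
    have := norm_eulerSeq_sub_le (hh n) (hκmono n hst)
      (fun k _ h2 => hfR T (hs.trans (hst.trans htT)) n k (h2.le.trans (hκmono n htT)))
    calc _ ≤ _ := this
      _ = _ := by ring
  have hderiv : ∀ t, 0 ≤ t → ∀ v, HasDerivAt z v t → v ∈ F (z t) := by
    intro t ht v hv
    rw [← (hcl (z t)).closure_eq, Metric.closure_eq_iInter_cthickening]
    refine mem_iInter₂.2 fun ε hε => ?_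
    set K := Metric.cthickening ε (F (z t)) with hK
    have hKcv : Convex ℝ K := (hcv _).cthickening _
    have hKcl : IsClosed K := Metric.isClosed_cthickening
    obtain ⟨η, hη, hηK⟩ := Metric.eventually_nhds_iff.1
      (hF.forall_isOpen (z t) _ (Metric.isOpen_thickening (δ := ε))
        (Metric.self_subset_thickening hε _))
    set M := C * R (t + 1) with hM
    have hM0 : 0 ≤ M := by positivity
    -- on a short interval after `t` the Euler iterates stay so close to `z t` that the values of `f`
    -- lie in the convex set `K`; hence so do the difference quotients, and their limit `v`
    have hsmall : ∀ᶠ s in 𝓝[>] (0 : ℝ), s⁻¹ • (z (t + s) - z t) ∈ K := by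
      have hpos : 0 < min 1 (η / (2 * (M + 1))) := by positivity
      filter_upwards [Ioo_mem_nhdsGT hpos] with s hs
      have hs0 : 0 < s := hs.1
      have hs1 : s ≤ 1 := hs.2.le.trans (min_le_left _ _)
      have hsM : M * s < η / 2 := by
        have h1 : s < η / (2 * (M + 1)) := hs.2.trans_le (min_le_right _ _)
        rw [lt_div_iff₀ (by positivity)] at h1
        nlinarith
      have hτ : Tendsto (fun n => ((κ n (t + s) : ℝ) - κ n t) * h n) u (𝓝 s) := by
        have h1 := ((hκlim (t + s) (by linarith)).sub (hκlim t ht)).mono_left hu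
        simpa [sub_mul] using h1
      refine hKcl.mem_of_tendsto
        ((hτ.inv₀ hs0.ne').smul ((hz (t + s)).sub (hz t))) ?_
      filter_upwards [hτ.eventually (lt_mem_nhds hs0),
        (hτ.const_mul M).eventually (gt_mem_nhds hsM),
        (hz t).eventually (Metric.ball_mem_nhds (z t) (half_pos hη))] with n h1 h2 h3
      have hlt : κ n t < κ n (t + s) := by
        have := (pos_iff_pos_of_mul_pos h1).2 (hh n)
        exact_mod_cast sub_pos.1 this
      refine inv_smul_eulerSeq_sub_mem (hh n) hKcv hlt fun k hk1 hk2 => ?_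
      refine Metric.thickening_subset_cthickening _ _ (hηK ?_ (hf _))
      have hkT : ∀ j, j < κ n (t + s) → j ≤ κ n (t + 1) := fun j hj =>
        hj.le.trans (hκmono n (by linarith))
      have h4 : ‖Y n k - Y n (κ n t)‖ ≤ M * (((k : ℝ) - κ n t) * h n) :=
        norm_eulerSeq_sub_le (hh n) hk1 fun j _ hj2 =>
          hfR (t + 1) (by linarith) n j (hkT j (hj2.trans hk2))
      have h5 : M * (((k : ℝ) - κ n t) * h n) ≤ M * (((κ n (t + s) : ℝ) - κ n t) * h n) := by
        have := (hh n).le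
        gcongr
      change dist (Y n k) (z t) < η
      calc dist (Y n k) (z t) ≤ dist (Y n k) (Y n (κ n t)) + dist (Y n (κ n t)) (z t) :=
            dist_triangle _ _ _
        _ < η / 2 + η / 2 := by
            rw [dist_eq_norm]
            exact add_lt_add (h4.trans_lt (h5.trans_lt h2)) h3
        _ = η := by ring
    exact hKcl.mem_of_tendsto hv.tendsto_slope_zero_right hsmall
  refine ⟨z, ⟨fun a ha b hb => ?_, ?_⟩, hz0⟩
  · exact absolutelyContinuousOnInterval_of_norm_sub_le fun s t hs hst ht =>
      hlip (max a b) s t ((le_min ha hb).trans hs) hst ht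
  · have hae : ∀ n : ℕ, ∀ᵐ t : ℝ, t ∈ Icc (0 : ℝ) n → DifferentiableWithinAt ℝ z (Icc 0 n) t := by
      intro n
      have hL : LipschitzOnWith (C * R n).toNNReal z (Icc 0 n) := by
        refine LipschitzOnWith.of_dist_le_mul fun s hs t ht => ?_
        have hRn : 0 ≤ C * R n := by simp only [hR]; positivity
        rw [Real.coe_toNNReal _ hRn]
        rcases le_total s t with hst | hst
        · rw [dist_comm, dist_eq_norm, dist_comm, Real.dist_eq, abs_of_nonneg (sub_nonneg.2 hst)]
          exact hlip n s t hs.1 hst ht.2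
        · rw [dist_eq_norm, Real.dist_eq, abs_of_nonneg (sub_nonneg.2 hst)]
          exact hlip n t s ht.1 hst hs.2
      exact hL.ae_differentiableWithinAt_of_mem_real
    have hne0 : ∀ᵐ t : ℝ, t ≠ 0 := by simp [ae_iff]
    filter_upwards [ae_all_iff.2 hae, hne0] with t ht ht0 htm
    have htpos : 0 < t := lt_of_le_of_ne htm (Ne.symm ht0)
    obtain ⟨n, hn⟩ := exists_nat_gt t
    have hd := (ht n ⟨htm, hn.le⟩).differentiableAt (Icc_mem_nhds htpos hn)
    exact ⟨_, hderiv t htm _ hd.hasDerivAt, hd.hasDerivAt⟩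

end Existence

/-! ### Continuation of bounded solutions -/

section Continuation

variable {E : Type*} [NormedAddCommGroup E] [NormedSpace ℝ E]

theorem IsSolutionOn.norm_sub_le {F : E → Set E} {J : Set ℝ} {z : ℝ → E} {C R s t : ℝ}
    (hC : 0 ≤ C) (hgr : ∀ x, ∀ v ∈ F x, ‖v‖ ≤ C * (1 + ‖x‖)) (hz : IsSolutionOn F J z)
    (hst : s ≤ t) (hJ : Icc s t ⊆ J) (hb : ∀ r ∈ Icc s t, ‖z r‖ ≤ R) :
    ‖z t - z s‖ ≤ C * (1 + R) * (t - s) := by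
  refine norm_sub_le_of_ae_hasDerivAt hst
    (hz.1 s (hJ (left_mem_Icc.2 hst)) t (hJ (right_mem_Icc.2 hst))) ?_
  filter_upwards [hz.2] with r hr hm
  obtain ⟨v, hv, hd⟩ := hr (hJ hm)
  refine ⟨v, (hgr _ v hv).trans ?_, hd⟩
  gcongr
  exact hb r hm

/-- A bounded solution on `[0, τ)` is Lipschitz, hence has a limit at `τ`, from which a global
solution takes over. -/
theorem IsSolutionOn.exists_continuation [FiniteDimensional ℝ E] {F : E → Set E} {z : ℝ → E}
    {C R τ : ℝ} (hC : 0 ≤ C) (hgr : ∀ x, ∀ v ∈ F x, ‖v‖ ≤ C * (1 + ‖x‖))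
    (hex : ∀ z₀, ∃ y : ℝ → E, IsSolutionOn F (Ici 0) y ∧ y 0 = z₀) (hτ : 0 < τ)
    (hz : IsSolutionOn F (Ico 0 τ) z) (hb : ∀ t ∈ Ico 0 τ, ‖z t‖ ≤ R) :
    ∃ w : ℝ → E, IsSolutionOn F (Ici 0) w ∧ EqOn w z (Ico 0 τ) := by
  have hR : 0 ≤ R := (norm_nonneg _).trans (hb 0 ⟨le_rfl, hτ⟩)
  have hzL : LipschitzOnWith (C * (1 + R)).toNNReal z (Ico 0 τ) := by
    have key : ∀ s t, 0 ≤ s → s ≤ t → t < τ → ‖z t - z s‖ ≤ C * (1 + R) * (t - s) :=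
      fun s t hs hst ht =>
        hz.norm_sub_le hC hgr hst (fun r hr => ⟨hs.trans hr.1, hr.2.trans_lt ht⟩)
          fun r hr => hb r ⟨hs.trans hr.1, hr.2.trans_lt ht⟩
    refine LipschitzOnWith.of_dist_le_mul fun s hs t ht => ?_
    rw [Real.coe_toNNReal _ (by positivity)]
    rcases le_total s t with hst | hst
    · rw [dist_comm, dist_eq_norm, dist_comm, Real.dist_eq, abs_of_nonneg (sub_nonneg.2 hst)]
      exact key s t hs.1 hst ht.2
    · rw [dist_eq_norm, Real.dist_eq, abs_of_nonneg (sub_nonneg.2 hst)]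
      exact key t s ht.1 hst hs.2
  obtain ⟨g, hg, hgz⟩ := hzL.extend_finite_dimension
  obtain ⟨y, hy, hy0⟩ := hex (g τ)
  set L := lipschitzExtensionConstant E * (C * (1 + R)).toNNReal
  have hgL : ∀ s t, s ≤ t → ‖g t - g s‖ ≤ L * (t - s) := fun s t hst => by
    have := hg.dist_le_mul t s
    rwa [dist_eq_norm, Real.dist_eq, abs_of_nonneg (sub_nonneg.2 hst)] at this
  set w : ℝ → E := fun t => if t < τ then g t else y (t - τ) with hw
  have hwl : ∀ t, t ≤ τ → w t = g t := fun t ht => by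
    rcases ht.lt_or_eq with h | rfl
    · simp [hw, h]
    · simp [hw, hy0]
  have hwr : ∀ t, τ ≤ t → w t = y (t - τ) := fun t ht => by simp [hw, not_lt.2 ht]
  refine ⟨w, ⟨fun a ha b hb' => ?_, ?_⟩, fun t ht => (hwl t ht.2.le).trans (hgz ht).symm⟩
  · set T := max (max a b) τ
    have hTτ : 0 ≤ T - τ := sub_nonneg.2 (le_max_right _ _)
    obtain ⟨R', hR'⟩ := (hy.1 0 self_mem_Ici (T - τ) hTτ).exists_bound
    rw [uIcc_of_le hTτ] at hR'
    have hyL : ∀ s t, 0 ≤ s → s ≤ t → t ≤ T - τ → ‖y t - y s‖ ≤ C * (1 + R') * (t - s) :=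
      fun s t hs hst ht => hy.norm_sub_le hC hgr hst (fun r hr => hs.trans hr.1)
        fun r hr => hR' r ⟨hs.trans hr.1, hr.2.trans ht⟩
    refine absolutelyContinuousOnInterval_of_norm_sub_le (K := max (L : ℝ) (C * (1 + R')))
      fun s t hs hst ht => ?_
    have hl : ∀ s t, s ≤ t → t ≤ τ → ‖w t - w s‖ ≤ max (L : ℝ) (C * (1 + R')) * (t - s) := by
      intro s t hst ht
      rw [hwl t ht, hwl s (hst.trans ht)]
      refine (hgL s t hst).trans ?_
      have := sub_nonneg.2 hst
      gcongr
      exact le_max_left _ _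
    have hr : ∀ s t, τ ≤ s → s ≤ t → t ≤ T →
        ‖w t - w s‖ ≤ max (L : ℝ) (C * (1 + R')) * (t - s) := by
      intro s t hs hst ht
      rw [hwr t (hs.trans hst), hwr s hs]
      refine (hyL (s - τ) (t - τ) (by linarith) (by linarith) (by linarith)).trans ?_
      have := sub_nonneg.2 hst
      rw [sub_sub_sub_cancel_right]
      gcongr
      exact le_max_right _ _
    have htT : t ≤ T := ht.trans (le_max_left _ _)
    rcases le_total t τ with h1 | h1
    · exact hl s t hst h1
    rcases le_total τ s with h2 | h2
    · exact hr s t h2 hst htT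
    calc ‖w t - w s‖ = ‖(w t - w τ) + (w τ - w s)‖ := by rw [sub_add_sub_cancel]
      _ ≤ _ := (norm_add_le _ _).trans (add_le_add (hr τ t le_rfl h1 htT) (hl s τ h2 le_rfl))
      _ = _ := by ring
  · have hshift := (measurePreserving_sub_right (volume : Measure ℝ) τ).quasiMeasurePreserving.ae
      hy.2
    have hne0 : ∀ᵐ t : ℝ, t ≠ 0 := by simp [ae_iff]
    have hneτ : ∀ᵐ t : ℝ, t ≠ τ := by simp [ae_iff]
    filter_upwards [hz.2, hshift, hne0, hneτ] with t h1 h2 h3 h4 ht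
    rcases lt_or_gt_of_ne h4 with h | h
    · have ht0 : 0 < t := lt_of_le_of_ne ht (Ne.symm h3)
      obtain ⟨v, hv, hd⟩ := h1 ⟨ht, h⟩
      have hwz : ∀ s ∈ Ico 0 τ, w s = z s := fun s hs => (hwl s hs.2.le).trans (hgz hs).symm
      rw [hwz t ⟨ht, h⟩]
      refine ⟨v, hv, hd.congr_of_eventuallyEq ?_⟩
      filter_upwards [Ioo_mem_nhds ht0 h] with s hs
      exact hwz s ⟨hs.1.le, hs.2⟩
    · obtain ⟨v, hv, hd⟩ := h2 (sub_nonneg.2 h.le)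
      rw [hwr t h.le]
      refine ⟨v, hv, (hd.comp_sub_const t τ).congr_of_eventuallyEq ?_⟩
      filter_upwards [Ioi_mem_nhds h] with s hs
      exact hwr s (le_of_lt hs)

end Continuation

/-! ### The potential and its gradient -/

section Potential

variable {E : Type*} [NormedAddCommGroup E] [InnerProductSpace ℝ E] [CompleteSpace E]
variable {U : E → ℝ}

/-- The standing assumption on the potential, in a general inner product space: `U` is strictly
convex, positive definite, continuously differentiable and homogeneous of degree `3 / 2`. -/
structure IsPotential (U : E → ℝ) : Prop where
  strictConvex : StrictConvexOn ℝ univ U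
  map_zero : U 0 = 0
  pos : ∀ x : E, x ≠ 0 → 0 < U x
  differentiable : Differentiable ℝ U
  homogeneous : ∀ (lam : ℝ) (x : E), 0 < lam → U (lam • x) = lam ^ (3 / 2 : ℝ) * U x
  continuous_gradient : Continuous (gradient U)

/-- The convex conjugate of `U` over a general inner product space; on a subspace of `ℝ^N` it is
`conjugate U` by definition. -/
noncomputable def convexConjugate (U : E → ℝ) (y : E) : ℝ :=
  ⨆ x : E, (inner ℝ x y - U x)

namespace IsPotential

theorem nonneg (hU : IsPotential U) (x : E) : 0 ≤ U x := by
  rcases eq_or_ne x 0 with rfl | h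
  · exact hU.map_zero.ge
  · exact (hU.pos x h).le

theorem hasGradientAt (hU : IsPotential U) (x : E) :
    HasGradientAt U (gradient U x) x :=
  (hU.differentiable x).hasGradientAt

theorem hasDerivAt_line (hU : IsPotential U) (x v : E) (t : ℝ) :
    HasDerivAt (fun t : ℝ => U (x + t • v)) (inner ℝ (gradient U (x + t • v)) v) t := by
  have h1 : HasDerivAt (fun t : ℝ => x + t • v) v t := by
    simpa using ((hasDerivAt_id t).smul_const v).const_add x
  exact (hU.hasGradientAt (x + t • v)).hasFDerivAt.comp_hasDerivAt t h1

/-- The tangent plane inequality for the convex function `U`. -/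
theorem add_inner_gradient_le (hU : IsPotential U) (x y : E) :
    U x + inner ℝ (gradient U x) (y - x) ≤ U y := by
  have hd := hU.hasDerivAt_line x (y - x) 0
  rw [zero_smul, add_zero] at hd
  have hlim := hd.tendsto_slope_zero_right
  have : inner ℝ (gradient U x) (y - x) ≤ U y - U x := by
    refine le_of_tendsto hlim ?_
    filter_upwards [Ioo_mem_nhdsGT (zero_lt_one (α := ℝ))] with t ht
    have hc := hU.strictConvex.convexOn.2 (mem_univ x) (mem_univ y) (sub_nonneg.2 ht.2.le)
      ht.1.le (by ring)
    have he : (1 - t) • x + t • y = x + t • (y - x) := by module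
    rw [he, smul_eq_mul, smul_eq_mul] at hc
    rw [zero_add, zero_smul, add_zero, smul_eq_mul, inv_mul_le_iff₀ ht.1]
    linarith
  linarith

theorem add_inner_gradient_lt (hU : IsPotential U) {x y : E} (hxy : x ≠ y) :
    U x + inner ℝ (gradient U x) (y - x) < U y := by
  have h1 := hU.strictConvex.2 (mem_univ x) (mem_univ y) hxy
    (show (0 : ℝ) < 1 / 2 by norm_num) (show (0 : ℝ) < 1 / 2 by norm_num) (by norm_num)
  have h2 := hU.add_inner_gradient_le x ((1 / 2 : ℝ) • x + (1 / 2 : ℝ) • y)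
  have he : (1 / 2 : ℝ) • x + (1 / 2 : ℝ) • y - x = (1 / 2 : ℝ) • (y - x) := by module
  rw [he, inner_smul_right] at h2
  simp only [smul_eq_mul] at h1
  linarith

theorem gradient_injective (hU : IsPotential U) :
    Function.Injective (gradient U) := by
  intro x y hxy
  by_contra hne
  have h1 := hU.add_inner_gradient_lt hne
  have h2 := hU.add_inner_gradient_lt (Ne.symm hne)
  rw [← hxy, ← neg_sub y x, inner_neg_right] at h2
  linarith

theorem gradient_zero (hU : IsPotential U) : gradient U 0 = 0 := by
  have hm : IsLocalMin U 0 := Eventually.of_forall fun y => by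
    rw [hU.map_zero]; exact hU.nonneg y
  rw [gradient, hm.fderiv_eq_zero, _root_.map_zero]

theorem map_sq_smul (hU : IsPotential U) {μ : ℝ} (hμ : 0 < μ) (x : E) :
    U (μ ^ 2 • x) = μ ^ 3 * U x := by
  rw [hU.homogeneous _ _ (by positivity)]
  congr 1
  rw [← Real.rpow_natCast μ 2, ← Real.rpow_mul hμ.le, ← Real.rpow_natCast μ 3]
  norm_num

theorem gradient_sq_smul (hU : IsPotential U) {μ : ℝ} (hμ : 0 < μ) (x : E) :
    gradient U (μ ^ 2 • x) = μ • gradient U x := by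
  have h1 : HasFDerivAt (fun y : E => U (μ ^ 2 • y))
      ((InnerProductSpace.toDual ℝ E (gradient U (μ ^ 2 • x))).comp
        (μ ^ 2 • ContinuousLinearMap.id ℝ E)) x :=
    (hU.hasGradientAt (μ ^ 2 • x)).hasFDerivAt.comp x ((hasFDerivAt_id x).const_smul (μ ^ 2))
  have h2 : HasFDerivAt (fun y : E => U (μ ^ 2 • y))
      (μ ^ 3 • InnerProductSpace.toDual ℝ E (gradient U x)) x := by
    simp only [hU.map_sq_smul hμ]
    exact (hU.hasGradientAt x).hasFDerivAt.const_mul (μ ^ 3)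
  refine ext_inner_right ℝ fun v => ?_
  have h3 := DFunLike.congr_fun (h1.unique h2) v
  simp only [ContinuousLinearMap.comp_apply, _root_.smul_apply,
    ContinuousLinearMap.id_apply, InnerProductSpace.toDual_apply_apply, inner_smul_right,
    smul_eq_mul] at h3
  rw [inner_smul_left]
  have : μ ^ 2 ≠ 0 := by positivity
  apply mul_left_cancel₀ this
  rw [h3]
  simp; ring

/-- Euler's identity for the homogeneous function `U` of degree `3 / 2`. -/
theorem inner_gradient_self (hU : IsPotential U) (x : E) :
    inner ℝ (gradient U x) x = 3 / 2 * U x := by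
  have h1 := hU.hasDerivAt_line 0 x 1
  simp only [zero_add, one_smul] at h1
  have h2 : HasDerivAt (fun t : ℝ => t ^ (3 / 2 : ℝ) * U x) (3 / 2 * U x) 1 := by
    simpa using (Real.hasDerivAt_rpow_const (x := 1) (p := 3 / 2) (Or.inl one_ne_zero)).mul_const
      (U x)
  refine (h1.congr_of_eventuallyEq ?_).unique h2
  filter_upwards [lt_mem_nhds (zero_lt_one (α := ℝ))] with t ht
  exact (hU.homogeneous t x ht).symm

/-- The tangent plane inequality says that the supremum defining the conjugate at `gradient U x` is
attained at `x`. -/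
theorem conjugate_gradient (hU : IsPotential U) (x : E) :
    convexConjugate U (gradient U x) = inner ℝ x (gradient U x) - U x := by
  have hub : ∀ z : E, inner ℝ z (gradient U x) - U z ≤ inner ℝ x (gradient U x) - U x := by
    intro z
    have := hU.add_inner_gradient_le x z
    rw [inner_sub_right, real_inner_comm z, real_inner_comm x] at this
    linarith
  exact le_antisymm (ciSup_le hub)
    (le_ciSup (f := fun z : E => inner ℝ z (gradient U x) - U z) ⟨_, forall_mem_range.2 hub⟩ x)

variable [FiniteDimensional ℝ E]

theorem exists_mul_sqrt_norm_le (hU : IsPotential U) :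
    ∃ c : ℝ, 0 < c ∧ ∀ x : E, c * (√‖x‖ * ‖x‖) ≤ U x := by
  obtain ⟨c, hc, h⟩ := (isCompact_sphere (0 : E) 1).exists_forall_le'
    (hU.differentiable.continuous.continuousOn) (a := 0)
    (fun x hx => hU.pos x (ne_zero_of_mem_unit_sphere ⟨x, hx⟩))
  refine ⟨c, hc, fun x => ?_⟩
  rcases eq_or_ne x 0 with rfl | hx
  · simp [hU.map_zero]
  have hx' : 0 < ‖x‖ := norm_pos_iff.2 hx
  have hs : √‖x‖ ^ 2 = ‖x‖ := Real.sq_sqrt hx'.le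
  have hy : U x = √‖x‖ ^ 3 * U (‖x‖⁻¹ • x) := by
    rw [← hU.map_sq_smul (Real.sqrt_pos.2 hx'), hs, smul_inv_smul₀ hx'.ne']
  have h1 := h (‖x‖⁻¹ • x) (by simp [norm_smul, hx'.ne'])
  rw [hy, pow_succ, hs, mul_comm c, mul_comm ‖x‖]
  gcongr

theorem exists_norm_gradient_le (hU : IsPotential U) :
    ∃ c : ℝ, 0 ≤ c ∧ ∀ x : E, ‖gradient U x‖ ≤ c * (1 + ‖x‖) := by
  obtain ⟨c, h⟩ := (isCompact_closedBall (0 : E) 1).exists_bound_of_continuousOn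
    hU.continuous_gradient.continuousOn
  have hc : 0 ≤ c := (norm_nonneg _).trans (h 0 (by simp))
  refine ⟨c, hc, fun x => ?_⟩
  rcases eq_or_ne x 0 with rfl | hx
  · simpa [hU.gradient_zero] using hc
  have hx' : 0 < ‖x‖ := norm_pos_iff.2 hx
  have hs : √‖x‖ ^ 2 = ‖x‖ := Real.sq_sqrt hx'.le
  have hy : gradient U x = √‖x‖ • gradient U (‖x‖⁻¹ • x) := by
    rw [← hU.gradient_sq_smul (Real.sqrt_pos.2 hx'), hs, smul_inv_smul₀ hx'.ne']
  have h1 := h (‖x‖⁻¹ • x) (by simp [norm_smul, hx'.ne'])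
  have h2 : √‖x‖ ≤ 1 + ‖x‖ := by nlinarith [sq_nonneg (√‖x‖ - 1), Real.sqrt_nonneg ‖x‖]
  rw [hy, norm_smul, Real.norm_of_nonneg (Real.sqrt_nonneg _), mul_comm]
  gcongr

theorem gradient_surjective (hU : IsPotential U) :
    Function.Surjective (gradient U) := by
  intro y
  obtain ⟨c, hc, h⟩ := hU.exists_mul_sqrt_norm_le
  have hcont : Continuous fun x : E => U x - inner ℝ y x :=
    hU.differentiable.continuous.sub (by fun_prop)
  have hcoer : ∀ᶠ x : E in cocompact E, U 0 - inner ℝ y 0 ≤ U x - inner ℝ y x := by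
    have ht := (Real.tendsto_sqrt_atTop.comp (tendsto_norm_cocompact_atTop (E := E))).const_mul_atTop
      hc
    filter_upwards [ht.eventually_ge_atTop ‖y‖] with x hx
    rw [hU.map_zero, inner_zero_right, sub_zero, sub_nonneg]
    calc inner ℝ y x ≤ ‖y‖ * ‖x‖ := real_inner_le_norm _ _
      _ ≤ c * √‖x‖ * ‖x‖ := by gcongr; exact hx
      _ ≤ U x := by rw [mul_assoc]; exact h x
  obtain ⟨x, hx⟩ := hcont.exists_forall_le' 0 hcoer
  refine ⟨x, ?_⟩
  have hm : IsLocalMin (fun x : E => U x - inner ℝ y x) x := Eventually.of_forall hx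
  have hd : HasFDerivAt (fun x : E => U x - inner ℝ y x)
      (InnerProductSpace.toDual ℝ E (gradient U x) - InnerProductSpace.toDual ℝ E y) x :=
    (hU.hasGradientAt x).hasFDerivAt.sub (InnerProductSpace.toDual ℝ E y).hasFDerivAt
  have := hm.hasFDerivAt_eq_zero hd
  exact (InnerProductSpace.toDual ℝ E).injective (sub_eq_zero.1 this)

/-- The gradient of `U` is a homeomorphism: it is a continuous bijection by strict convexity and
coercivity, and it is proper because it grows like the square root of the norm. -/
theorem exists_continuous_inverse (hU : IsPotential U) :
    ∃ p : E → E, Continuous p ∧ (∀ y, gradient U (p y) = y) ∧ ∀ x, p (gradient U x) = x := by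
  obtain ⟨c, hc, h⟩ := hU.exists_mul_sqrt_norm_le
  have hge : ∀ x : E, c * √‖x‖ ≤ ‖gradient U x‖ := fun x => by
    rcases eq_or_ne x 0 with rfl | hx
    · simp
    have hx' : 0 < ‖x‖ := norm_pos_iff.2 hx
    refine le_of_mul_le_mul_right ?_ hx'
    calc c * √‖x‖ * ‖x‖ ≤ U x := by rw [mul_assoc]; exact h x
      _ ≤ inner ℝ (gradient U x) x := by
        rw [hU.inner_gradient_self]; linarith [hU.nonneg x]
      _ ≤ ‖gradient U x‖ * ‖x‖ := real_inner_le_norm _ _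
  have hprop : IsProperMap (gradient U) := by
    refine isProperMap_iff_tendsto_cocompact.2 ⟨hU.continuous_gradient, ?_⟩
    refine tendsto_cocompact_of_tendsto_dist_comp_atTop 0 ?_
    simp only [dist_zero_right]
    exact tendsto_atTop_mono hge
      ((Real.tendsto_sqrt_atTop.comp tendsto_norm_cocompact_atTop).const_mul_atTop hc)
  let e := (Equiv.ofBijective _ ⟨hU.gradient_injective, hU.gradient_surjective⟩)
  let e' := e.toHomeomorphOfContinuousClosed hU.continuous_gradient hprop.isClosedMap
  exact ⟨e'.symm, e'.symm.continuous, e.apply_symm_apply, e.symm_apply_apply⟩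

/-! ### The convex conjugate -/

/-- The Fenchel-Young inequality. -/
theorem inner_le_add_conjugate (hU : IsPotential U) (x y : E) :
    inner ℝ x y ≤ U x + convexConjugate U y := by
  obtain ⟨z, rfl⟩ := hU.gradient_surjective y
  rw [hU.conjugate_gradient]
  have := hU.add_inner_gradient_le z x
  rw [inner_sub_right, real_inner_comm x, real_inner_comm z] at this
  linarith

/-- The conjugate is differentiable and its gradient inverts the gradient of `U`: its increments
lie between those of the two tangent planes `p y` and `p y'`, and `p` is continuous. -/
theorem hasGradientAt_conjugate_of_inverse (hU : IsPotential U) {p : E → E}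
    (hp : Continuous p) (hGp : ∀ y, gradient U (p y) = y) (y : E) :
    HasGradientAt (convexConjugate U) (p y) y := by
  have hval : ∀ y, convexConjugate U y = inner ℝ (p y) y - U (p y) := fun y => by
    simpa [hGp] using hU.conjugate_gradient (p y)
  rw [hasGradientAt_iff_isLittleO, Asymptotics.isLittleO_iff]
  intro c hc
  filter_upwards [hp.continuousAt.eventually (Metric.closedBall_mem_nhds (p y) hc)] with y' hy'
  change dist (p y') (p y) ≤ c at hy'
  rw [dist_eq_norm] at hy'
  have h1 := hU.inner_le_add_conjugate (p y) y'
  have h2 := hU.inner_le_add_conjugate (p y') y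
  have h3 := hval y
  have h4 := hval y'
  have h5 : inner ℝ (p y' - p y) (y' - y) ≤ c * ‖y' - y‖ :=
    (real_inner_le_norm _ _).trans (by gcongr)
  simp only [inner_sub_left, inner_sub_right] at h5 ⊢
  rw [Real.norm_eq_abs, abs_le]
  constructor <;> linarith [norm_nonneg (y' - y), mul_nonneg hc.le (norm_nonneg (y' - y))]

theorem gradient_conjugate_eq (hU : IsPotential U) {p : E → E}
    (hp : Continuous p) (hGp : ∀ y, gradient U (p y) = y) : gradient (convexConjugate U) = p :=
  gradient_eq (hU.hasGradientAt_conjugate_of_inverse hp hGp)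

theorem continuous_gradient_conjugate (hU : IsPotential U) :
    Continuous (gradient (convexConjugate U)) := by
  obtain ⟨p, hp, hGp, -⟩ := hU.exists_continuous_inverse
  rwa [hU.gradient_conjugate_eq hp hGp]

theorem gradient_gradient_conjugate (hU : IsPotential U) (y : E) :
    gradient U (gradient (convexConjugate U) y) = y := by
  obtain ⟨p, hp, hGp, -⟩ := hU.exists_continuous_inverse
  rw [hU.gradient_conjugate_eq hp hGp, hGp]

theorem gradient_conjugate_gradient (hU : IsPotential U) (x : E) :
    gradient (convexConjugate U) (gradient U x) = x :=
  hU.gradient_injective (hU.gradient_gradient_conjugate _)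

theorem hasGradientAt_conjugate (hU : IsPotential U) (y : E) :
    HasGradientAt (convexConjugate U) (gradient (convexConjugate U) y) y :=
  hU.hasGradientAt_conjugate_of_inverse hU.continuous_gradient_conjugate
    hU.gradient_gradient_conjugate y

theorem conjugate_eq (hU : IsPotential U) (y : E) :
    convexConjugate U y = 1 / 2 * U (gradient (convexConjugate U) y) := by
  have h1 := hU.conjugate_gradient (gradient (convexConjugate U) y)
  have h2 := hU.inner_gradient_self (gradient (convexConjugate U) y)
  rw [hU.gradient_gradient_conjugate] at h1 h2
  rw [real_inner_comm] at h2
  linarith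

theorem inner_gradient_conjugate_self (hU : IsPotential U) (y : E) :
    inner ℝ (gradient (convexConjugate U) y) y = 3 * convexConjugate U y := by
  have h2 := hU.inner_gradient_self (gradient (convexConjugate U) y)
  rw [hU.gradient_gradient_conjugate, real_inner_comm] at h2
  rw [h2, hU.conjugate_eq]
  ring

theorem gradient_conjugate_smul (hU : IsPotential U) {μ : ℝ} (hμ : 0 < μ) (y : E) :
    gradient (convexConjugate U) (μ • y) = μ ^ 2 • gradient (convexConjugate U) y := by
  apply hU.gradient_injective
  rw [hU.gradient_gradient_conjugate, hU.gradient_sq_smul hμ, hU.gradient_gradient_conjugate]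

theorem conjugate_smul (hU : IsPotential U) {μ : ℝ} (hμ : 0 < μ) (y : E) :
    convexConjugate U (μ • y) = μ ^ 3 * convexConjugate U y := by
  rw [hU.conjugate_eq, hU.gradient_conjugate_smul hμ, hU.map_sq_smul hμ, hU.conjugate_eq]
  ring

theorem conjugate_nonneg (hU : IsPotential U) (y : E) : 0 ≤ convexConjugate U y := by
  rw [hU.conjugate_eq]
  linarith [hU.nonneg (gradient (convexConjugate U) y)]

theorem conjugate_pos (hU : IsPotential U) {y : E} (hy : y ≠ 0) :
    0 < convexConjugate U y := by
  rw [hU.conjugate_eq]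
  have : gradient (convexConjugate U) y ≠ 0 := fun h => hy (by
    rw [← hU.gradient_gradient_conjugate y, h, hU.gradient_zero])
  linarith [hU.pos _ this]

end IsPotential

end Potential

/-! ### Upper hemicontinuous maps that are homogeneous of degree zero -/

section Lyapunov

/-- The topological assumptions on the set-valued map: bounded closed values, upper hemicontinuity
and homogeneity of degree `0`. -/
structure IsHomogeneousMultimap {E : Type*} [NormedAddCommGroup E] [NormedSpace ℝ E]
    (S : E → Set E) : Prop where
  homogeneous : ∀ (lam : ℝ) (x : E), 0 < lam → S (lam • x) = S x
  bounded : ∀ x, Bornology.IsBounded (S x)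
  closed : ∀ x, IsClosed (S x)
  upperHemicontinuous : UpperHemicontinuous S

namespace IsHomogeneousMultimap

variable {E : Type*} [NormedAddCommGroup E] [NormedSpace ℝ E] {S : E → Set E}

theorem exists_norm_le [FiniteDimensional ℝ E] (hS : IsHomogeneousMultimap S) :
    ∃ R : ℝ, 0 ≤ R ∧ ∀ x, ∀ s ∈ S x, ‖s‖ ≤ R := by
  have : ProperSpace E := FiniteDimensional.proper ℝ E
  have key : ∃ R : ℝ, ∀ x ∈ Metric.closedBall (0 : E) 1, ∀ s ∈ S x, ‖s‖ ≤ R := by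
    refine (isCompact_closedBall (0 : E) 1).induction_on
      (p := fun K => ∃ R : ℝ, ∀ x ∈ K, ∀ s ∈ S x, ‖s‖ ≤ R) ⟨0, by simp⟩ ?_ ?_ ?_
    · rintro K K' hK ⟨R, hR⟩
      exact ⟨R, fun x hx => hR x (hK hx)⟩
    · rintro K K' ⟨R, hR⟩ ⟨R', hR'⟩
      refine ⟨max R R', ?_⟩
      rintro x (hx | hx) s hs
      · exact (hR x hx s hs).trans (le_max_left _ _)
      · exact (hR' x hx s hs).trans (le_max_right _ _)
    · intro x _
      obtain ⟨r, hr⟩ := (hS.bounded x).subset_ball 0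
      have := hS.upperHemicontinuous.forall_isOpen x _ Metric.isOpen_ball hr
      refine ⟨_, mem_nhdsWithin_of_mem_nhds this, r, fun y hy s hs => ?_⟩
      exact (mem_ball_zero_iff.1 (hy hs)).le
  obtain ⟨R, hR⟩ := key
  refine ⟨max R 0, le_max_right _ _, fun x s hs => le_trans ?_ (le_max_left _ _)⟩
  rcases eq_or_ne x 0 with rfl | hx
  · exact hR 0 (by simp) s hs
  · have hx' : 0 < ‖x‖ := norm_pos_iff.2 hx
    refine hR (‖x‖⁻¹ • x) (by simp [norm_smul, hx'.ne']) s ?_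
    rwa [hS.homogeneous _ _ (inv_pos.2 hx')]

theorem isClosed_graph (hS : IsHomogeneousMultimap S) :
    IsClosed {q : E × E | q.2 ∈ S q.1} := by
  refine isClosed_of_closure_subset fun q hq => ?_
  obtain ⟨u, hu, hlim⟩ := mem_closure_iff_seq_limit.1 hq
  exact UpperHemicontinuousAt.mem_of_tendsto (hS.upperHemicontinuous q.1) (hS.closed q.1)
    (continuous_fst.continuousAt.tendsto.comp hlim) (Frequently.of_forall hu)
    (continuous_snd.continuousAt.tendsto.comp hlim)

end IsHomogeneousMultimap

/-! ### The weighted homogeneous gauge -/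

section Gauge

variable {E : Type*} [NormedAddCommGroup E]

/-- A gauge on `E × E` that is homogeneous of degree one for the dilations
`(x₀, x₁) ↦ (μ² x₀, μ x₁)`. -/
noncomputable def gauge₂ (x : E × E) : ℝ :=
  √‖x.1‖ + ‖x.2‖

theorem continuous_gauge₂ : Continuous (gauge₂ : E × E → ℝ) := by
  unfold gauge₂; fun_prop

theorem gauge₂_nonneg (x : E × E) : 0 ≤ gauge₂ x := by
  unfold gauge₂; positivity

theorem gauge₂_pos {x : E × E} (hx : x ≠ 0) : 0 < gauge₂ x := by
  unfold gauge₂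
  rcases eq_or_ne x.1 0 with h | h
  · have h2 : x.2 ≠ 0 := fun h2 => hx (Prod.ext h h2)
    have := norm_pos_iff.2 h2
    positivity
  · have := norm_pos_iff.2 h
    positivity

theorem norm_fst_le_gauge₂ (x : E × E) : ‖x.1‖ ≤ gauge₂ x ^ 2 := by
  rw [← Real.sq_sqrt (norm_nonneg x.1)]
  unfold gauge₂
  gcongr
  exact le_add_of_nonneg_right (norm_nonneg _)

theorem norm_snd_le_gauge₂ (x : E × E) : ‖x.2‖ ≤ gauge₂ x :=
  le_add_of_nonneg_left (Real.sqrt_nonneg _)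

variable [NormedSpace ℝ E]

theorem gauge₂_dilation {μ : ℝ} (hμ : 0 ≤ μ) (x : E × E) :
    gauge₂ (μ ^ 2 • x.1, μ • x.2) = μ * gauge₂ x := by
  simp only [gauge₂, norm_smul, norm_pow, Real.norm_of_nonneg hμ]
  rw [Real.sqrt_mul (by positivity), Real.sqrt_sq hμ]
  ring

theorem isCompact_gauge₂_eq_one [FiniteDimensional ℝ E] :
    IsCompact {x : E × E | gauge₂ x = 1} := by
  have : ProperSpace E := FiniteDimensional.proper ℝ E
  refine Metric.isCompact_of_isClosed_isBounded
    (isClosed_eq continuous_gauge₂ continuous_const)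
    (Metric.isBounded_closedBall.subset (t := Metric.closedBall 0 1) fun x hx => ?_)
  rw [mem_closedBall_zero_iff, Prod.norm_def, max_le_iff]
  have h1 := norm_fst_le_gauge₂ x
  have h2 := norm_snd_le_gauge₂ x
  rw [mem_ofPred_eq] at hx
  rw [hx] at h1 h2
  exact ⟨by simpa using h1, h2⟩

/-- Every nonzero point is a dilation of a point of the unit gauge sphere. -/
theorem exists_eq_dilation {x : E × E} (hx : x ≠ 0) :
    ∃ y : E × E, gauge₂ y = 1 ∧ x = (gauge₂ x ^ 2 • y.1, gauge₂ x • y.2) := by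
  have h := gauge₂_pos hx
  refine ⟨((gauge₂ x)⁻¹ ^ 2 • x.1, (gauge₂ x)⁻¹ • x.2), ?_, ?_⟩
  · rw [gauge₂_dilation (inv_nonneg.2 h.le), inv_mul_cancel₀ h.ne']
  · have h2 : gauge₂ x ^ 2 ≠ 0 := by positivity
    simp [smul_smul, h.ne', h2]

end Gauge

/-! ### The Lyapunov function -/

variable {E : Type*} [NormedAddCommGroup E] [InnerProductSpace ℝ E] [CompleteSpace E]
  {U : E → ℝ}

/-- The Lyapunov function: the Fenchel gap `U x₀ + U* x₁ - ⟨x₀, x₁⟩` plus `β U* x₁`. -/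
noncomputable def lyapunov (U : E → ℝ) (β : ℝ) (x : E × E) : ℝ :=
  U x.1 - inner ℝ x.1 x.2 + (1 + β) * convexConjugate U x.2

/-- The derivative of the Lyapunov function along the undamped system in normalised time, for the
selections `s` and `d` of the multimap and of the disturbance. -/
noncomputable def decayRate (U : E → ℝ) (β k₀ k₁ : ℝ) (x : E × E) (s d : E) : ℝ :=
  -‖gradient U x.1 - x.2‖ ^ 2 +
    1 / k₀ * inner ℝ ((1 + β) • gradient (convexConjugate U) x.2 - x.1)
      (-(k₁ / k₀) • (s - (1 / k₁) • d))

namespace IsPotential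

theorem lyapunov_zero (hU : IsPotential U) (β : ℝ) : lyapunov U β 0 = 0 := by
  have := hU.conjugate_gradient 0
  rw [hU.gradient_zero] at this
  simp [lyapunov, this, hU.map_zero]

variable [FiniteDimensional ℝ E]

theorem hasFDerivAt_lyapunov (hU : IsPotential U) (β : ℝ) (x : E × E) :
    HasFDerivAt (lyapunov U β)
      ((InnerProductSpace.toDual ℝ E (gradient U x.1 - x.2)).comp (ContinuousLinearMap.fst ℝ E E) +
        (InnerProductSpace.toDual ℝ E
          ((1 + β) • gradient (convexConjugate U) x.2 - x.1)).comp
            (ContinuousLinearMap.snd ℝ E E)) x := by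
  have h1 := (hU.hasGradientAt x.1).hasFDerivAt.comp x (hasFDerivAt_fst (𝕜 := ℝ) (p := x))
  have h2 := (hU.hasGradientAt_conjugate x.2).hasFDerivAt.comp x (hasFDerivAt_snd (𝕜 := ℝ) (p := x))
  have h3 := (hasFDerivAt_fst (𝕜 := ℝ) (p := x)).inner ℝ (hasFDerivAt_snd (𝕜 := ℝ) (p := x))
  refine ((h1.sub h3).add (h2.const_mul (1 + β))).congr_fderiv ?_
  ext v
  · simp [real_inner_comm, fderivInnerCLM_apply]
  · simp [real_inner_comm, fderivInnerCLM_apply]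
    ring

theorem contDiff_lyapunov (hU : IsPotential U) (β : ℝ) : ContDiff ℝ 1 (lyapunov U β) := by
  rw [contDiff_one_iff_fderiv]
  refine ⟨fun x => (hU.hasFDerivAt_lyapunov β x).differentiableAt, ?_⟩
  have : fderiv ℝ (lyapunov U β) = _ := funext fun x => (hU.hasFDerivAt_lyapunov β x).fderiv
  rw [this]
  have h1 := hU.continuous_gradient
  have h2 := hU.continuous_gradient_conjugate
  refine Continuous.add ?_ ?_
  · refine ((ContinuousLinearMap.compL ℝ (E × E) E ℝ).flip
      (ContinuousLinearMap.fst ℝ E E)).continuous.comp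
        ((InnerProductSpace.toDual ℝ E).continuous.comp ?_)
    fun_prop
  · refine ((ContinuousLinearMap.compL ℝ (E × E) E ℝ).flip
      (ContinuousLinearMap.snd ℝ E E)).continuous.comp
        ((InnerProductSpace.toDual ℝ E).continuous.comp ?_)
    fun_prop

theorem hasDerivAt_lyapunov (hU : IsPotential U) (β : ℝ) {a b : ℝ → E} {a' b' : E} {t : ℝ}
    (ha : HasDerivAt a a' t) (hb : HasDerivAt b b' t) :
    HasDerivAt (fun t => lyapunov U β (a t, b t))
      (inner ℝ (gradient U (a t) - b t) a' +
        inner ℝ ((1 + β) • gradient (convexConjugate U) (b t) - a t) b') t := by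
  exact (hU.hasFDerivAt_lyapunov β (a t, b t)).comp_hasDerivAt t (ha.prodMk hb)

theorem lyapunov_pos (hU : IsPotential U) {β : ℝ} (hβ : 0 < β) {x : E × E} (hx : x ≠ 0) :
    0 < lyapunov U β x := by
  have h1 := hU.inner_le_add_conjugate x.1 x.2
  unfold lyapunov
  rcases eq_or_ne x.2 0 with h | h
  · have h2 : x.1 ≠ 0 := fun h2 => hx (Prod.ext h2 h)
    have h3 := hU.pos _ h2
    have h4 := hU.conjugate_nonneg x.2
    rw [h, inner_zero_right] at *
    have := mul_nonneg (by linarith : 0 ≤ 1 + β) h4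
    linarith
  · have := mul_pos hβ (hU.conjugate_pos h)
    linarith

theorem lyapunov_dilation (hU : IsPotential U) (β : ℝ) {μ : ℝ} (hμ : 0 < μ) (x : E × E) :
    lyapunov U β (μ ^ 2 • x.1, μ • x.2) = μ ^ 3 * lyapunov U β x := by
  simp only [lyapunov, hU.map_sq_smul hμ, hU.conjugate_smul hμ, real_inner_smul_left,
    real_inner_smul_right]
  ring

theorem decayRate_dilation (hU : IsPotential U) (β k₀ k₁ : ℝ) {μ : ℝ} (hμ : 0 < μ) (x : E × E)
    (s d : E) :
    decayRate U β k₀ k₁ (μ ^ 2 • x.1, μ • x.2) s d = μ ^ 2 * decayRate U β k₀ k₁ x s d := by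
  have h1 : (1 + β) • μ ^ 2 • gradient (convexConjugate U) x.2 - μ ^ 2 • x.1 =
      μ ^ 2 • ((1 + β) • gradient (convexConjugate U) x.2 - x.1) := by module
  simp only [decayRate, hU.gradient_sq_smul hμ, hU.gradient_conjugate_smul hμ, ← smul_sub, h1,
    norm_smul, real_inner_smul_left, mul_pow, Real.norm_eq_abs, sq_abs]
  ring

/-- The linear damping does not increase the Lyapunov function. By homogeneity its contribution is
`3/2 U a - 2⟨a, b⟩ + 3 (1 + β) U* b`, and the Fenchel-Young inequality for the rescaled pair
`(μ² a, μ⁻² b)` bounds the middle term. -/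
theorem damping_nonneg (hU : IsPotential U) {β : ℝ} (hβ : 7 ≤ β) (a b : E) :
    0 ≤ inner ℝ (gradient U a - b) a +
      inner ℝ ((1 + β) • gradient (convexConjugate U) b - a) b := by
  rw [inner_sub_left, inner_sub_left, real_inner_smul_left, hU.inner_gradient_self,
    hU.inner_gradient_conjugate_self, real_inner_comm a b]
  -- any `μ` with `2 μ³ ≤ 3/2` and `2 μ⁻⁶ ≤ 24` will do
  have h1 := hU.inner_le_add_conjugate ((4 / 5 : ℝ) ^ 2 • a) ((25 / 16 : ℝ) • b)
  have hb : convexConjugate U ((25 / 16 : ℝ) • b) = (25 / 16) ^ 3 * convexConjugate U b :=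
    hU.conjugate_smul (by norm_num) b
  rw [hU.map_sq_smul (by norm_num), hb, real_inner_smul_left, real_inner_smul_right] at h1
  have h2 := hU.nonneg a
  have h3 := hU.conjugate_nonneg b
  nlinarith

/-- The derivative of the Lyapunov function along the super-twisting vector field, in the
coordinates `(a, b)` with `e₀ = a` and `e₁ = k₀ √L b`. -/
theorem lyapunov_deriv_le (hU : IsPotential U) {β L γ k₀ k₁ : ℝ} (hβ : 7 ≤ β) (hL : 0 < L)
    (hγ : 0 ≤ γ) (hk₀ : 0 < k₀) (hk₁ : 0 < k₁) (a b s d : E) :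
    inner ℝ (gradient U a - b) (-(k₀ * √L) • gradient U a + (k₀ * √L) • b - γ • a) +
      inner ℝ ((1 + β) • gradient (convexConjugate U) b - a)
        ((k₀ * √L)⁻¹ • (-(k₁ * L) • s - γ • (k₀ * √L) • b + L • d)) ≤
      k₀ * √L * decayRate U β k₀ k₁ (a, b) s d := by
  obtain ⟨r, hr, rfl⟩ : ∃ r, 0 < r ∧ L = r ^ 2 :=
    ⟨√L, Real.sqrt_pos.2 hL, (Real.sq_sqrt hL.le).symm⟩
  rw [Real.sqrt_sq hr.le]
  have h1 : -(k₀ * r) • gradient U a + (k₀ * r) • b - γ • a =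
      -(k₀ * r) • (gradient U a - b) - γ • a := by module
  have h2 : (k₀ * r)⁻¹ • (-(k₁ * r ^ 2) • s - γ • (k₀ * r) • b + r ^ 2 • d) =
      r • (-(k₁ / k₀) • (s - (1 / k₁) • d)) - γ • b := by
    match_scalars <;> field_simp
  rw [h1, h2, inner_sub_right, inner_sub_right _ _ (γ • b), real_inner_smul_right,
    real_inner_self_eq_norm_sq, real_inner_smul_right _ _ γ, real_inner_smul_right _ _ r,
    real_inner_smul_right _ b γ, decayRate]
  have h3 := mul_nonneg hγ (hU.damping_nonneg hβ a b)
  have h4 : k₀ * r * (1 / k₀) = r := by field_simp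
  linear_combination h3 - h4 * inner ℝ ((1 + β) • gradient (convexConjugate U) b - a)
      (-(k₁ / k₀) • (s - (1 / k₁) • d))

theorem exists_gauge₂_le_lyapunov (hU : IsPotential U) {β : ℝ} (hβ : 0 < β) :
    ∃ m : ℝ, 0 < m ∧ ∀ x : E × E, m * gauge₂ x ^ 3 ≤ lyapunov U β x := by
  obtain ⟨m, hm, h⟩ := (isCompact_gauge₂_eq_one (E := E)).exists_forall_le'
    (hU.contDiff_lyapunov β).continuous.continuousOn (a := 0) fun x hx => hU.lyapunov_pos hβ (by
      rintro rfl
      simp [gauge₂] at hx)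
  refine ⟨m, hm, fun x => ?_⟩
  rcases eq_or_ne x 0 with rfl | hx
  · simp [gauge₂, hU.lyapunov_zero]
  have h0 := gauge₂_pos hx
  obtain ⟨y, hy, hxy⟩ := exists_eq_dilation hx
  have h1 := hU.lyapunov_dilation β h0 y
  rw [← hxy] at h1
  rw [h1, mul_comm]
  gcongr
  exact h y hy

/-- If the decay rate is negative away from the origin, it is bounded by a negative multiple of the
power `2 / 3` of the Lyapunov function: on the gauge sphere this is compactness of the graph of the
multimap, elsewhere it is homogeneity (the degrees are `2` and `3`). -/
theorem exists_decayRate_le (hU : IsPotential U) {S : E → Set E} (hS : IsHomogeneousMultimap S)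
    {D : Set E} (hD : IsCompact D) {β k₀ k₁ : ℝ} (hβ : 0 < β)
    (hneg : ∀ x : E × E, x ≠ 0 → ∀ s ∈ S x.1, ∀ d ∈ D, decayRate U β k₀ k₁ x s d < 0) :
    ∃ c : ℝ, 0 < c ∧ ∀ x : E × E, ∀ s ∈ S x.1, ∀ d ∈ D,
      decayRate U β k₀ k₁ x s d ≤ -c * lyapunov U β x ^ (2 / 3 : ℝ) := by
  obtain ⟨R, -, hR⟩ := hS.exists_norm_le
  have hcomp : IsCompact {q : (E × E) × E × E | gauge₂ q.1 = 1 ∧ q.2.1 ∈ S q.1.1 ∧ q.2.2 ∈ D} := by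
    refine ((isCompact_gauge₂_eq_one (E := E)).prod
      ((isCompact_closedBall (0 : E) R).prod hD)).of_isClosed_subset ?_ ?_
    · refine (isClosed_eq (continuous_gauge₂.comp continuous_fst) continuous_const).inter
        (IsClosed.inter ?_ (hD.isClosed.preimage (continuous_snd.comp continuous_snd)))
      exact hS.isClosed_graph.preimage (f := fun q : (E × E) × E × E => (q.1.1, q.2.1))
        (by fun_prop)
    · rintro q ⟨h1, h2, h3⟩
      exact ⟨h1, by simpa using hR _ _ h2, h3⟩
  have hcont : Continuous fun q : (E × E) × E × E =>
      -decayRate U β k₀ k₁ q.1 q.2.1 q.2.2 := by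
    have h1 := hU.continuous_gradient
    have h2 := hU.continuous_gradient_conjugate
    unfold decayRate
    fun_prop
  obtain ⟨c, hc, h⟩ := hcomp.exists_forall_le' hcont.continuousOn (a := 0) (by
    rintro ⟨x, s, d⟩ ⟨h1, h2, h3⟩
    refine neg_pos.2 (hneg x ?_ s h2 d h3)
    rintro rfl
    simp [gauge₂] at h1)
  obtain ⟨M, hM⟩ := (isCompact_gauge₂_eq_one (E := E)).exists_bound_of_continuousOn
    (hU.contDiff_lyapunov β).continuous.continuousOn
  have hM' : 0 < max M 1 := by positivity
  refine ⟨c / max M 1 ^ (2 / 3 : ℝ), by positivity, fun x s hs d hd => ?_⟩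
  rcases eq_or_ne x 0 with rfl | hx
  · have h0 : gradient (convexConjugate U) 0 = 0 := by
      simpa [hU.gradient_zero] using hU.gradient_conjugate_gradient 0
    rw [hU.lyapunov_zero, Real.zero_rpow (by norm_num)]
    simp [decayRate, hU.gradient_zero, h0]
  have h0 := gauge₂_pos hx
  obtain ⟨y, hy, hxy⟩ := exists_eq_dilation hx
  have h1 := hU.lyapunov_dilation β h0 y
  have h2 := hU.decayRate_dilation β k₀ k₁ h0 y s d
  have hs' : s ∈ S y.1 := by
    rw [hxy] at hs
    rwa [hS.homogeneous _ _ (by positivity)] at hs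
  have h3 := h (y, s, d) ⟨hy, hs', hd⟩
  rw [← hxy] at h1 h2
  have h4 : lyapunov U β y ≤ max M 1 := (le_abs_self _).trans ((hM y hy).trans (le_max_left _ _))
  have hVy : 0 ≤ lyapunov U β y := (hU.lyapunov_pos hβ (by rintro rfl; simp [gauge₂] at hy)).le
  have h5 : lyapunov U β x ^ (2 / 3 : ℝ) ≤ gauge₂ x ^ 2 * max M 1 ^ (2 / 3 : ℝ) := by
    rw [h1, Real.mul_rpow (by positivity) hVy, ← Real.rpow_natCast, ← Real.rpow_mul h0.le]
    norm_num
    gcongr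
  have h6 : c / max M 1 ^ (2 / 3 : ℝ) * lyapunov U β x ^ (2 / 3 : ℝ) ≤ c * gauge₂ x ^ 2 := by
    rw [div_mul_eq_mul_div, div_le_iff₀ (by positivity), mul_assoc]
    gcongr
  rw [h2]
  simp only at h3
  nlinarith [sq_nonneg (gauge₂ x)]

end IsPotential

end Lyapunov

/-! ### Finite-time convergence of a scalar function -/

theorem absolutelyContinuousOnInterval_comp_contDiffOn {E F : Type*} [NormedAddCommGroup E]
    [NormedSpace ℝ E] [NormedAddCommGroup F] [NormedSpace ℝ F] {φ : E → F} {s : Set E}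
    {z : ℝ → E} {a b : ℝ} (hφ : ContDiffOn ℝ 1 φ s) (hs : Convex ℝ s) (hs' : IsCompact s)
    (hz : AbsolutelyContinuousOnInterval z a b) (hm : MapsTo z (uIcc a b) s) :
    AbsolutelyContinuousOnInterval (fun t => φ (z t)) a b := by
  obtain ⟨K, hK⟩ := hφ.exists_lipschitzOnWith one_ne_zero hs hs'
  exact absolutelyContinuousOnInterval_comp hK hz hm

/-- A nonnegative function with `v' ≤ -c v ^ (2 / 3)` vanishes after the time `3 v(0) ^ (1 / 3) / c`,
because `v ^ (1 / 3)` decreases at least at the rate `c / 3` as long as `v` is positive. -/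
theorem eq_zero_of_hasDerivAt_le_neg_rpow {v : ℝ → ℝ} {c : ℝ} (hc : 0 < c)
    (hv : ∀ t, 0 ≤ v t)
    (hac : ∀ t, 0 ≤ t → AbsolutelyContinuousOnInterval v 0 t)
    (hd : ∀ᵐ t : ℝ, 0 ≤ t → ∃ r ≤ -c * v t ^ (2 / 3 : ℝ), HasDerivAt v r t) {t : ℝ} (ht0 : 0 ≤ t)
    (ht : 3 / c * v 0 ^ (1 / 3 : ℝ) ≤ t) : v t = 0 := by
  have hanti : ∀ s s', 0 ≤ s → s ≤ s' → v s' ≤ v s := by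
    intro s s' hs hss
    have := sub_le_of_ae_hasDerivAt_le (c := 0) hss ((hac s' (hs.trans hss)).mono (by
      rw [uIcc_of_le hss, uIcc_of_le (hs.trans hss)]
      exact Icc_subset_Icc_left hs)) (by
        filter_upwards [hd] with r hr hm
        obtain ⟨w, hw, hdw⟩ := hr (hs.trans hm.1)
        refine ⟨w, hw.trans ?_, hdw⟩
        have := Real.rpow_nonneg (hv r) (2 / 3)
        nlinarith)
    linarith
  by_contra hne
  have hpos : 0 < v t := lt_of_le_of_ne (hv t) (Ne.symm hne)
  have hmaps : MapsTo v (uIcc 0 t) (Icc (v t) (v 0)) := by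
    rw [uIcc_of_le ht0]
    exact fun s hs => ⟨hanti s t hs.1 hs.2, hanti 0 s le_rfl hs.1⟩
  have hroot : AbsolutelyContinuousOnInterval (fun s => v s ^ (1 / 3 : ℝ)) 0 t :=
    absolutelyContinuousOnInterval_comp_contDiffOn (φ := fun y : ℝ => y ^ (1 / 3 : ℝ))
      (contDiffOn_id.rpow_const_of_ne fun y hy => (hpos.trans_le hy.1).ne')
      (convex_Icc _ _) isCompact_Icc (hac t ht0) hmaps
  have := sub_le_of_ae_hasDerivAt_le (c := -(c / 3)) ht0 hroot (by
    filter_upwards [hd] with s hs hm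
    obtain ⟨r, hr, hdr⟩ := hs hm.1
    have hvs : 0 < v s := hpos.trans_le (hanti s t hm.1 hm.2)
    refine ⟨_, ?_, hdr.rpow_const (Or.inl hvs.ne')⟩
    have h1 : v s ^ (2 / 3 : ℝ) * v s ^ ((1 : ℝ) / 3 - 1) = 1 := by
      rw [← Real.rpow_add hvs]; norm_num
    have h2 := Real.rpow_nonneg (hv s) ((1 : ℝ) / 3 - 1)
    calc r * (1 / 3) * v s ^ ((1 : ℝ) / 3 - 1)
        ≤ -c * v s ^ (2 / 3 : ℝ) * (1 / 3) * v s ^ ((1 : ℝ) / 3 - 1) := by gcongr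
      _ = -(c / 3) * (v s ^ (2 / 3 : ℝ) * v s ^ ((1 : ℝ) / 3 - 1)) := by ring
      _ = -(c / 3) := by rw [h1, mul_one])
  have h1 : 0 < v t ^ (1 / 3 : ℝ) := Real.rpow_pos_of_pos hpos _
  have h2 : v 0 ^ (1 / 3 : ℝ) ≤ c / 3 * t := by
    calc v 0 ^ (1 / 3 : ℝ) = c / 3 * (3 / c * v 0 ^ (1 / 3 : ℝ)) := by field_simp
      _ ≤ c / 3 * t := by gcongr
  linarith

/-! ### The Lyapunov function in the original coordinates -/

section Scaled

variable {E : Type*} [NormedAddCommGroup E] [InnerProductSpace ℝ E] [CompleteSpace E]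
  {U : E → ℝ}

/-- The Lyapunov function in the coordinates `(e₀, e₁) = (x₀, κ x₁)`. -/
noncomputable def scaledLyapunov (U : E → ℝ) (β κ : ℝ) (e : E × E) : ℝ :=
  lyapunov U β (e.1, κ⁻¹ • e.2)

namespace IsPotential

theorem scaledLyapunov_zero (hU : IsPotential U) (β κ : ℝ) : scaledLyapunov U β κ 0 = 0 := by
  simpa [scaledLyapunov] using! hU.lyapunov_zero β

variable [FiniteDimensional ℝ E]

theorem contDiff_scaledLyapunov (hU : IsPotential U) (β κ : ℝ) :
    ContDiff ℝ 1 (scaledLyapunov U β κ) :=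
  (hU.contDiff_lyapunov β).comp (by fun_prop : ContDiff ℝ 1 fun e : E × E => (e.1, κ⁻¹ • e.2))

theorem scaledLyapunov_nonneg (hU : IsPotential U) {β κ : ℝ} (hβ : 0 < β) (e : E × E) :
    0 ≤ scaledLyapunov U β κ e := by
  unfold scaledLyapunov
  rcases eq_or_ne (e.1, κ⁻¹ • e.2) 0 with h | h
  · rw [h, hU.lyapunov_zero]
  · exact (hU.lyapunov_pos hβ h).le

theorem eq_zero_of_scaledLyapunov_eq_zero (hU : IsPotential U) {β κ : ℝ} (hβ : 0 < β) (hκ : κ ≠ 0)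
    {e : E × E} (he : scaledLyapunov U β κ e = 0) : e = 0 := by
  by_contra hne
  refine (hU.lyapunov_pos hβ (x := (e.1, κ⁻¹ • e.2)) fun h => hne ?_).ne' he
  rw [Prod.mk_eq_zero, smul_eq_zero] at h
  exact Prod.ext h.1 (h.2.resolve_left (inv_ne_zero hκ))

/-- The sublevel sets of the Lyapunov function shrink to the origin. -/
theorem exists_norm_lt_of_scaledLyapunov_lt (hU : IsPotential U) {β κ ε : ℝ} (hβ : 0 < β)
    (hκ : 0 < κ) (hε : 0 < ε) :
    ∃ η : ℝ, 0 < η ∧ ∀ e : E × E, scaledLyapunov U β κ e < η → ‖e‖ < ε := by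
  obtain ⟨m, hm, h⟩ := hU.exists_gauge₂_le_lyapunov hβ
  set r := min (min 1 ε) (ε / κ) with hr
  have hr0 : 0 < r := by positivity
  refine ⟨m * r ^ 3, by positivity, fun e he => ?_⟩
  set g := gauge₂ (e.1, κ⁻¹ • e.2) with hg
  have hg0 : 0 ≤ g := gauge₂_nonneg _
  have hgr : g < r := by
    have h1 := lt_of_mul_lt_mul_left ((h (e.1, κ⁻¹ • e.2)).trans_lt he) hm.le
    exact lt_of_pow_lt_pow_left₀ 3 hr0.le h1
  have h1 : ‖e.1‖ ≤ g ^ 2 := norm_fst_le_gauge₂ (e.1, κ⁻¹ • e.2)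
  have h2 : ‖κ⁻¹ • e.2‖ ≤ g := norm_snd_le_gauge₂ (e.1, κ⁻¹ • e.2)
  rw [norm_smul, Real.norm_of_nonneg (inv_nonneg.2 hκ.le), inv_mul_le_iff₀ hκ] at h2
  have hr1 : r ≤ 1 := (min_le_left _ _).trans (min_le_left _ _)
  have hr2 : r ≤ ε := (min_le_left _ _).trans (min_le_right _ _)
  have hr3 : r ≤ ε / κ := min_le_right _ _
  rw [le_div_iff₀ hκ] at hr3
  rw [Prod.norm_def, max_lt_iff]
  constructor <;> nlinarith

/-- The Lyapunov function is coercive: by homogeneity it grows at least like the cube of the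
gauge. -/
theorem exists_norm_le_of_scaledLyapunov_le (hU : IsPotential U) {β κ : ℝ} (hβ : 0 < β)
    (hκ : 0 < κ) (B : ℝ) :
    ∃ R : ℝ, ∀ e : E × E, scaledLyapunov U β κ e ≤ B → ‖e‖ ≤ R := by
  obtain ⟨m, hm, h⟩ := hU.exists_gauge₂_le_lyapunov hβ
  set r := max 1 (B / m) with hr
  have hr1 : 1 ≤ r := le_max_left _ _
  refine ⟨max (r ^ 2) (κ * r), fun e he => ?_⟩
  set g := gauge₂ (e.1, κ⁻¹ • e.2) with hg
  have hg0 : 0 ≤ g := gauge₂_nonneg _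
  have hgr : g ≤ r := by
    have h1 : g ^ 3 ≤ r ^ 3 := by
      have h2 : g ^ 3 ≤ B / m := by
        rw [le_div_iff₀ hm, mul_comm]
        exact (h (e.1, κ⁻¹ • e.2)).trans he
      exact h2.trans ((le_max_right _ _).trans (le_self_pow₀ hr1 (by norm_num)))
    exact le_of_pow_le_pow_left₀ (by norm_num) (by positivity) h1
  have h1 : ‖e.1‖ ≤ g ^ 2 := norm_fst_le_gauge₂ (e.1, κ⁻¹ • e.2)
  have h2 : ‖κ⁻¹ • e.2‖ ≤ g := norm_snd_le_gauge₂ (e.1, κ⁻¹ • e.2)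
  rw [norm_smul, Real.norm_of_nonneg (inv_nonneg.2 hκ.le), inv_mul_le_iff₀ hκ] at h2
  rw [Prod.norm_def]
  refine max_le_max (h1.trans (by gcongr)) (h2.trans (by gcongr))

theorem exists_hasDerivAt_scaledLyapunov_le (hU : IsPotential U) {β L γ k₀ k₁ : ℝ} (hβ : 7 ≤ β)
    (hL : 0 < L) (hγ : 0 ≤ γ) (hk₀ : 0 < k₀) (hk₁ : 0 < k₁) {z : ℝ → E × E} {v : E × E} {t : ℝ}
    {s d : E} (hz : HasDerivAt z v t)
    (hv₁ : v.1 = -(k₀ * √L) • gradient U (z t).1 + (z t).2 - γ • (z t).1)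
    (hv₂ : v.2 = -(k₁ * L) • s - γ • (z t).2 + L • d) :
    ∃ r ≤ k₀ * √L * decayRate U β k₀ k₁ ((z t).1, (k₀ * √L)⁻¹ • (z t).2) s d,
      HasDerivAt (fun t => scaledLyapunov U β (k₀ * √L) (z t)) r t := by
  have hκ : k₀ * √L ≠ 0 := (mul_pos hk₀ (Real.sqrt_pos.2 hL)).ne'
  have h1 : HasDerivAt (fun t => (z t).1) v.1 t :=
    (ContinuousLinearMap.fst ℝ E E).hasFDerivAt.comp_hasDerivAt t hz
  have h2 : HasDerivAt (fun t => (z t).2) v.2 t :=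
    (ContinuousLinearMap.snd ℝ E E).hasFDerivAt.comp_hasDerivAt t hz
  refine ⟨_, ?_, hU.hasDerivAt_lyapunov β h1 (h2.const_smul (k₀ * √L)⁻¹)⟩
  have h3 := hU.lyapunov_deriv_le hβ hL hγ hk₀ hk₁ (z t).1 ((k₀ * √L)⁻¹ • (z t).2) s d
  rw [smul_inv_smul₀ hκ] at h3
  rwa [hv₁, hv₂]

end IsPotential

end Scaled

/-! ### The super-twisting system: existence and growth -/

variable {N : ℕ} {X : Submodule ℝ (EuclideanSpace ℝ (Fin N))}
  {U : X → ℝ} {S : X → Set X} {D : Set X} {cS : ℝ}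

namespace BasicAssumption

theorem isPotential (hA : BasicAssumption U S D cS) : IsPotential U :=
  ⟨hA.U_strictConvex, hA.U_zero, hA.U_pos, hA.U_differentiable, hA.U_homogeneous,
    hA.gradient_U_continuous⟩

theorem isHomogeneousMultimap (hA : BasicAssumption U S D cS) : IsHomogeneousMultimap S :=
  ⟨hA.S_homogeneous, hA.S_bounded, hA.S_closed, hA.S_upperSemicontinuous⟩

theorem norm_le_one (hA : BasicAssumption U S D cS) {d : X} (hd : d ∈ D) : ‖d‖ ≤ 1 :=
  hA.D_sup_norm.1 (mem_image_of_mem _ hd)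

theorem D_nonempty (hA : BasicAssumption U S D cS) : D.Nonempty := by
  rw [nonempty_iff_ne_empty]
  rintro h
  have : (1 : ℝ) ≤ 0 := hA.D_sup_norm.2 (by simp [h, upperBounds])
  linarith

theorem exists_growth (hA : BasicAssumption U S D cS) (L γ k₀ k₁ : ℝ) (hL : 0 < L) (hγ : 0 ≤ γ)
    (hk₀ : 0 < k₀) (hk₁ : 0 < k₁) :
    ∃ C : ℝ, 0 ≤ C ∧ ∀ e, ∀ v ∈ superTwisting U S D L γ k₀ k₁ e, ‖v‖ ≤ C * (1 + ‖e‖) := by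
  obtain ⟨g, hg, hgrad⟩ := hA.isPotential.exists_norm_gradient_le
  obtain ⟨R, hR, hS⟩ := hA.isHomogeneousMultimap.exists_norm_le
  have hsL := Real.sqrt_nonneg L
  refine ⟨k₀ * √L * g + 1 + γ + k₁ * L * R + L, by positivity, fun e v hv => ?_⟩
  obtain ⟨hv₁, s, hs, d, hd, hv₂⟩ := hv
  have he₁ : ‖e.1‖ ≤ ‖e‖ := norm_fst_le e
  have he₂ : ‖e.2‖ ≤ ‖e‖ := norm_snd_le e
  have hn := norm_nonneg e
  have h1 : ‖v.1‖ ≤ k₀ * √L * (g * (1 + ‖e‖)) + ‖e‖ + γ * ‖e‖ := by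
    rw [hv₁]
    refine (norm_sub_le _ _).trans (add_le_add ((norm_add_le _ _).trans (add_le_add ?_ he₂)) ?_)
    · rw [norm_smul, norm_neg, Real.norm_of_nonneg (by positivity)]
      gcongr
      exact (hgrad _).trans (by gcongr)
    · rw [norm_smul, Real.norm_of_nonneg hγ]
      gcongr
  have h2 : ‖v.2‖ ≤ k₁ * L * R + γ * ‖e‖ + L * 1 := by
    rw [hv₂]
    refine (norm_add_le _ _).trans (add_le_add ((norm_sub_le _ _).trans (add_le_add ?_ ?_)) ?_)
    · rw [norm_smul, norm_neg, Real.norm_of_nonneg (by positivity)]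
      gcongr
      exact hS _ s hs
    · rw [norm_smul, Real.norm_of_nonneg hγ]
      gcongr
    · rw [norm_smul, Real.norm_of_nonneg hL.le]
      gcongr
      exact hA.norm_le_one hd
  have hp1 : 0 ≤ k₀ * √L * g := by positivity
  have hp2 : 0 ≤ k₁ * L * R := by positivity
  rw [Prod.norm_def, max_le_iff]
  constructor
  · nlinarith [mul_nonneg hp2 hn, mul_nonneg hL.le hn, mul_nonneg hγ hn]
  · nlinarith [mul_nonneg hp1 hn, mul_nonneg hp2 hn, mul_nonneg hL.le hn, mul_nonneg hγ hn]

/-- The set `D` need not be convex, so the existence theorem is applied with one fixed disturbance,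
which makes the right-hand side convex-valued. -/
theorem exists_solution (hA : BasicAssumption U S D cS) (L γ k₀ k₁ : ℝ) (hL : 0 < L) (hγ : 0 ≤ γ)
    (hk₀ : 0 < k₀) (hk₁ : 0 < k₁) (z₀ : X × X) :
    ∃ z : ℝ → X × X, IsSolutionOn (superTwisting U S D L γ k₀ k₁) (Ici 0) z ∧ z 0 = z₀ := by
  obtain ⟨d, hd⟩ := hA.D_nonempty
  obtain ⟨C, hC, hgr⟩ := hA.exists_growth L γ k₀ k₁ hL hγ hk₀ hk₁
  set F := superTwisting U S {d} L γ k₀ k₁ with hF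
  have hsub : ∀ e, F e ⊆ superTwisting U S D L γ k₀ k₁ e := by
    rintro e v ⟨h1, s, hs, d', rfl, h2⟩
    exact ⟨h1, s, hs, d', hd, h2⟩
  have hiff : ∀ e v, v ∈ F e ↔ v.1 = -(k₀ * √L) • gradient U e.1 + e.2 - γ • e.1 ∧
      (k₁ * L)⁻¹ • (L • d - γ • e.2 - v.2) ∈ S e.1 := by
    intro e v
    have hne : k₁ * L ≠ 0 := (mul_pos hk₁ hL).ne'
    refine and_congr_right fun _ => ⟨?_, fun h => ⟨_, h, d, rfl, ?_⟩⟩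
    · rintro ⟨s, hs, d', rfl, h⟩
      have : (k₁ * L)⁻¹ • (L • d' - γ • e.2 - v.2) = s := by
        rw [inv_smul_eq_iff₀ hne, h]; module
      rwa [this]
    · rw [neg_smul, smul_inv_smul₀ hne]; module
  have hclosed : IsClosed {q : (X × X) × X × X | q.2 ∈ F q.1} := by
    simp only [hiff]
    have hg := hA.gradient_U_continuous
    refine IsClosed.inter (isClosed_eq (by fun_prop) (by fun_prop)) ?_
    exact hA.isHomogeneousMultimap.isClosed_graph.preimage
      (f := fun q : (X × X) × X × X => (q.1.1, (k₁ * L)⁻¹ • (L • d - γ • q.1.2 - q.2.2)))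
      (by fun_prop)
  have huhc : UpperHemicontinuous F := fun e => by
    refine UpperHemicontinuousAt.of_sequences (f := F)
      (isCompact_closedBall (0 : X × X) (C * (1 + (‖e‖ + 1)))).isSeqCompact ?_ ?_
    · have : ∀ᶠ e' in 𝓝 e, ‖e'‖ < ‖e‖ + 1 :=
        continuous_norm.continuousAt.eventually (gt_mem_nhds (lt_add_one _))
      filter_upwards [this] with e' he' v hv
      rw [mem_closedBall_zero_iff]
      exact (hgr e' v (hsub e' hv)).trans (by gcongr)
    · intro x hx y hy y₀ hy₀
      exact hclosed.mem_of_tendsto (hx.prodMk_nhds hy₀) (Eventually.of_forall hy)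
  obtain ⟨z, hz, hz0⟩ := exists_isSolutionOn_Ici (F := F) hC
    (fun e => by
      obtain ⟨s, hs⟩ := hA.S_nonempty e.1
      exact ⟨(_, _), rfl, s, hs, d, rfl, rfl⟩)
    (fun e => hclosed.preimage (f := fun v => (e, v)) (by fun_prop))
    (fun e v hv w hw a b ha hb hab => by
      rw [hiff] at hv hw ⊢
      refine ⟨?_, ?_⟩
      · rw [Prod.fst_add, Prod.smul_fst, Prod.smul_fst, hv.1, hw.1, ← add_smul, hab, one_smul]
      · have := hA.S_convex e.1 hv.2 hw.2 ha hb hab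
        convert this using 1
        obtain rfl : a = 1 - b := by linarith
        rw [Prod.snd_add, Prod.smul_snd, Prod.smul_snd]
        module)
    huhc (fun e v hv => hgr e v (hsub e hv)) z₀
  refine ⟨z, ⟨hz.1, ?_⟩, hz0⟩
  filter_upwards [hz.2] with t ht hm
  obtain ⟨v, hv, hdv⟩ := ht hm
  exact ⟨v, hsub _ hv, hdv⟩

end BasicAssumption

/-! ### The gain conditions make the decay rate negative -/

theorem homNorm_dilation {μ : ℝ} (hμ : 0 < μ) (x : X × X) :
    homNorm (μ ^ 2 • x.1, μ • x.2) = μ * homNorm x := by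
  have h : ∀ r : ℝ, |μ ^ 2 * r| ^ (1 / 2 : ℝ) = μ * |r| ^ (1 / 2 : ℝ) := fun r => by
    rw [abs_mul, abs_of_pos (by positivity : 0 < μ ^ 2),
      Real.mul_rpow (by positivity) (abs_nonneg r), ← Real.rpow_natCast, ← Real.rpow_mul hμ.le]
    norm_num
  simp only [homNorm, Submodule.coe_smul, PiLp.smul_apply, smul_eq_mul, h, abs_mul μ,
    abs_of_pos hμ, ← Finset.mul_sum, mul_add]

theorem homNorm_pos {x : X × X} (hx : x ≠ 0) : 0 < homNorm x := by
  have h1 : 0 ≤ ∑ i : Fin N, |(x.1 : EuclideanSpace ℝ (Fin N)) i| ^ (1 / 2 : ℝ) :=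
    Finset.sum_nonneg fun i _ => by positivity
  have h2 : 0 ≤ ∑ i : Fin N, |(x.2 : EuclideanSpace ℝ (Fin N)) i| :=
    Finset.sum_nonneg fun i _ => by positivity
  refine lt_of_le_of_ne (add_nonneg h1 h2) fun h => hx ?_
  obtain ⟨h3, h4⟩ := (add_eq_zero_iff_of_nonneg h1 h2).1 h.symm
  rw [Finset.sum_eq_zero_iff_of_nonneg (fun i _ => by positivity)] at h3 h4
  refine Prod.ext (Subtype.ext (PiLp.ext fun i => ?_)) (Subtype.ext (PiLp.ext fun i => ?_))
  · have := h3 i (Finset.mem_univ i)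
    rw [Real.rpow_eq_zero (abs_nonneg _) (by norm_num)] at this
    simpa using this
  · simpa using h4 i (Finset.mem_univ i)

namespace BasicAssumption

/-- Where the first component of the undamped system vanishes, the multimap dominates the
disturbance because `k₁ cS > 1`. -/
theorem decayRate_neg_of_gradient_eq (hA : BasicAssumption U S D cS) {β k₀ k₁ : ℝ} (hβ : 0 < β)
    (hk₀ : 0 < k₀) (hk₁ : 0 < k₁) (hgain₁ : 1 / cS < k₁) {x : X × X} (hx : x ≠ 0)
    (hgr : gradient U x.1 = x.2) {s d : X} (hs : s ∈ S x.1) (hd : d ∈ D) :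
    decayRate U β k₀ k₁ x s d < 0 := by
  have hx1 : x.1 ≠ 0 := fun h => hx (Prod.ext h (by
    rw [← hgr, h, hA.isPotential.gradient_zero]; rfl))
  have hn : 0 < ‖x.1‖ := norm_pos_iff.2 hx1
  have h1 : (1 + β) • gradient (convexConjugate U) x.2 - x.1 = β • x.1 := by
    rw [← hgr, hA.isPotential.gradient_conjugate_gradient]; module
  have h2 : cS * ‖x.1‖ ≤ inner ℝ x.1 s := by
    rw [real_inner_comm]; exact hA.S_inner _ _ hs
  have h3 : inner ℝ x.1 d ≤ ‖x.1‖ := by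
    refine (real_inner_le_norm _ _).trans ?_
    have := hA.norm_le_one hd
    nlinarith
  have h4 : 1 < k₁ * cS := by rwa [div_lt_iff₀ hA.cS_pos] at hgain₁
  have h5 : decayRate U β k₀ k₁ x s d =
      -(β / k₀ ^ 2) * (k₁ * inner ℝ x.1 s - inner ℝ x.1 d) := by
    rw [decayRate, hgr, sub_self, norm_zero, h1, real_inner_smul_left x.1 _ β,
      real_inner_smul_right x.1 _ (-(k₁ / k₀)), inner_sub_right x.1,
      real_inner_smul_right x.1 d (1 / k₁)]
    field_simp
    ring
  rw [h5]
  have h6 : 0 < k₁ * inner ℝ x.1 s - inner ℝ x.1 d := by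
    nlinarith [mul_le_mul_of_nonneg_left h2 hk₁.le]
  have h7 : 0 < β / k₀ ^ 2 := by positivity
  nlinarith

/-- The gain conditions make the decay rate negative away from the origin. -/
theorem decayRate_neg (hA : BasicAssumption U S D cS) {β k₀ k₁ : ℝ} (hβ : 0 < β)
    (hk₀ : 0 < k₀) (hk₁ : 0 < k₁)
    (hgain₀ : (⨆ x ∈ {x : X × X | homNorm x = 1 ∧ 0 < Gam U x},
      ((Pie U S D β k₀ k₁ x / Gam U x : ℝ) : EReal)) < (k₀ : EReal))
    (hgain₁ : 1 / cS < k₁) (x : X × X) (hx : x ≠ 0) (s : X) (hs : s ∈ S x.1) (d : X)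
    (hd : d ∈ D) : decayRate U β k₀ k₁ x s d < 0 := by
  by_cases hgr : gradient U x.1 = x.2
  · exact hA.decayRate_neg_of_gradient_eq hβ hk₀ hk₁ hgain₁ hx hgr hs hd
  -- `hgain₀` speaks about the unit sphere of `homNorm` only, so `x` is moved there by a dilation
  set μ := homNorm x with hμ
  have hμ0 : 0 < μ := homNorm_pos hx
  set y : X × X := (μ⁻¹ ^ 2 • x.1, μ⁻¹ • x.2) with hy
  have hy1 : homNorm y = 1 := by
    rw [hy, homNorm_dilation (inv_pos.2 hμ0), ← hμ, inv_mul_cancel₀ hμ0.ne']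
  have hsy : s ∈ S y.1 := by
    rwa [hy, hA.S_homogeneous _ _ (by positivity)]
  have hscale := hA.isPotential.decayRate_dilation β k₀ k₁ (inv_pos.2 hμ0) x s d
  have hΓ : 0 < Gam U y := by
    have h1 : gradient U y.1 - y.2 = μ⁻¹ • (gradient U x.1 - x.2) := by
      rw [hy, hA.isPotential.gradient_sq_smul (inv_pos.2 hμ0), smul_sub]
    rw [Gam, h1]
    have h2 : gradient U x.1 - x.2 ≠ 0 := sub_ne_zero.2 hgr
    have h3 : μ⁻¹ • (gradient U x.1 - x.2) ≠ 0 := smul_ne_zero (inv_pos.2 hμ0).ne' h2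
    have := norm_pos_iff.2 h3
    positivity
  have hlt : Pie U S D β k₀ k₁ y / Gam U y < k₀ := by
    have h1 := (le_iSup₂ (f := fun (x : X × X)
      (_ : x ∈ {x : X × X | homNorm x = 1 ∧ 0 < Gam U x}) =>
        ((Pie U S D β k₀ k₁ x / Gam U x : ℝ) : EReal)) y ⟨hy1, hΓ⟩).trans_lt hgain₀
    exact_mod_cast h1
  rw [div_lt_iff₀ hΓ] at hlt
  -- boundedness of `S` and `D` makes the supremum `Pie` an upper bound rather than a junk value
  obtain ⟨R, hR, hSR⟩ := hA.isHomogeneousMultimap.exists_norm_le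
  set w := (1 + β) • gradient (conjugate U) y.2 - y.1 with hw
  have hle : inner ℝ w (-(k₁ / k₀) • (s - (1 / k₁) • d)) ≤ Pie U S D β k₀ k₁ y := by
    refine le_csSup ⟨‖w‖ * (k₁ / k₀ * (R + 1 / k₁ * 1)), ?_⟩ ⟨s, hsy, d, hd, rfl⟩
    rintro p ⟨s', hs', d', hd', rfl⟩
    refine (real_inner_le_norm _ _).trans ?_
    rw [norm_smul, norm_neg, Real.norm_of_nonneg (by positivity : 0 ≤ k₁ / k₀)]
    gcongr
    refine (norm_sub_le _ _).trans (add_le_add (hSR _ _ hs') ?_)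
    rw [norm_smul, Real.norm_of_nonneg (by positivity)]
    gcongr
    exact hA.norm_le_one hd'
  have hneg : decayRate U β k₀ k₁ y s d < 0 := by
    have h1 : decayRate U β k₀ k₁ y s d =
        -Gam U y + 1 / k₀ * inner ℝ w (-(k₁ / k₀) • (s - (1 / k₁) • d)) := rfl
    have h2 : 1 / k₀ * inner ℝ w (-(k₁ / k₀) • (s - (1 / k₁) • d)) < Gam U y := by
      rw [one_div, inv_mul_lt_iff₀ hk₀]
      exact hle.trans_lt hlt
    rw [h1]
    linarith
  rw [hscale] at hneg
  exact neg_of_mul_neg_right hneg (by positivity)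

/-! ### Finite-time stability -/

/-- The Lyapunov function satisfies `V' ≤ -κ c V ^ (2 / 3)` along every solution. Its sublevel sets are
bounded and shrink to the origin, which gives continuation and Lyapunov stability, and the inequality
forces `V` to vanish after a time that depends on `V (z 0)` only. -/
theorem globallyFiniteTimeStable (hA : BasicAssumption U S D cS) {L γ k₀ k₁ β : ℝ} (hL : 0 < L)
    (hγ : 0 ≤ γ) (hk₀ : 0 < k₀) (hk₁ : 0 < k₁) (hβ : 7 ≤ β)
    (hgain₀ : (⨆ x ∈ {x : X × X | homNorm x = 1 ∧ 0 < Gam U x},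
      ((Pie U S D β k₀ k₁ x / Gam U x : ℝ) : EReal)) < (k₀ : EReal))
    (hgain₁ : 1 / cS < k₁) :
    GloballyFiniteTimeStable (superTwisting U S D L γ k₀ k₁) := by
  have hU := hA.isPotential
  have hβ0 : 0 < β := by linarith
  set κ := k₀ * √L with hκ_def
  have hκ : 0 < κ := mul_pos hk₀ (Real.sqrt_pos.2 hL)
  set V := scaledLyapunov U β κ with hV
  have hV0 : ∀ e, 0 ≤ V e := hU.scaledLyapunov_nonneg hβ0
  have hVC : ContDiff ℝ 1 V := hU.contDiff_scaledLyapunov β κ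
  obtain ⟨c, hc, hdecay⟩ := hU.exists_decayRate_le hA.isHomogeneousMultimap hA.D_compact hβ0
    (hA.decayRate_neg hβ0 hk₀ hk₁ hgain₀ hgain₁)
  obtain ⟨C, hC, hgr⟩ := hA.exists_growth L γ k₀ k₁ hL hγ hk₀ hk₁
  have hκc : 0 < κ * c := mul_pos hκ hc
  have hac : ∀ J z, IsSolutionOn (superTwisting U S D L γ k₀ k₁) J z → ∀ a ∈ J, ∀ b ∈ J,
      AbsolutelyContinuousOnInterval (fun t => V (z t)) a b := by
    intro J z hz a ha b hb
    obtain ⟨R, hR⟩ := (hz.1 a ha b hb).exists_bound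
    exact absolutelyContinuousOnInterval_comp_contDiffOn (hVC.contDiffOn (s := univ) |>.mono
      (subset_univ _)) (convex_closedBall 0 R) (isCompact_closedBall 0 R) (hz.1 a ha b hb)
      fun t ht => by simpa using hR t ht
  have hder : ∀ J z, IsSolutionOn (superTwisting U S D L γ k₀ k₁) J z →
      ∀ᵐ t : ℝ, t ∈ J → ∃ r ≤ -(κ * c) * V (z t) ^ (2 / 3 : ℝ),
        HasDerivAt (fun t => V (z t)) r t := by
    intro J z hz
    filter_upwards [hz.2] with t ht hm
    obtain ⟨v, ⟨hv₁, s, hs, d, hd, hv₂⟩, hdv⟩ := ht hm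
    obtain ⟨r, hr, hdr⟩ := hU.exists_hasDerivAt_scaledLyapunov_le hβ hL hγ hk₀ hk₁ hdv hv₁ hv₂
    refine ⟨r, hr.trans ?_, hdr⟩
    have := hdecay ((z t).1, κ⁻¹ • (z t).2) s hs d hd
    calc κ * decayRate U β k₀ k₁ ((z t).1, κ⁻¹ • (z t).2) s d
        ≤ κ * (-c * V (z t) ^ (2 / 3 : ℝ)) := by gcongr; exact this
      _ = _ := by ring
  have hanti : ∀ J z, IsSolutionOn (superTwisting U S D L γ k₀ k₁) J z → ∀ t, 0 ≤ t →
      Icc 0 t ⊆ J → V (z t) ≤ V (z 0) := by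
    intro J z hz t ht hJ
    have := sub_le_of_ae_hasDerivAt_le (c := 0) ht
      (hac J z hz 0 (hJ (left_mem_Icc.2 ht)) t (hJ (right_mem_Icc.2 ht))) (by
        filter_upwards [hder J z hz] with r hr hm
        obtain ⟨w, hw, hdw⟩ := hr (hJ hm)
        refine ⟨w, hw.trans ?_, hdw⟩
        have := Real.rpow_nonneg (hV0 (z r)) (2 / 3)
        nlinarith)
    linarith
  refine ⟨hA.exists_solution L γ k₀ k₁ hL hγ hk₀ hk₁, ?_, ?_, ?_⟩
  · intro τ hτ z hz
    obtain ⟨R, hR⟩ := hU.exists_norm_le_of_scaledLyapunov_le hβ0 hκ (V (z 0))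
    exact hz.exists_continuation hC hgr (hA.exists_solution L γ k₀ k₁ hL hγ hk₀ hk₁) hτ
      fun t ht => hR _ (hanti _ z hz t ht.1 fun s hs => ⟨hs.1, hs.2.trans_lt ht.2⟩)
  · intro ε hε
    obtain ⟨η, hη, h⟩ := hU.exists_norm_lt_of_scaledLyapunov_lt hβ0 hκ hε
    have hlim : ∀ᶠ e in 𝓝 (0 : X × X), V e < η := by
      refine hVC.continuous.continuousAt.eventually (gt_mem_nhds ?_)
      rw [hV, hU.scaledLyapunov_zero]
      exact hη
    obtain ⟨δ, hδ, hball⟩ := Metric.eventually_nhds_iff.1 hlim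
    refine ⟨δ, hδ, fun z hz hz0 t ht => h _ ((hanti _ z hz t ht fun s hs => hs.1).trans_lt ?_)⟩
    exact hball (by simpa using hz0)
  · intro z₀
    refine ⟨3 / (κ * c) * V z₀ ^ (1 / 3 : ℝ),
      mul_nonneg (by positivity) (Real.rpow_nonneg (hV0 _) _), ?_⟩
    rintro z hz rfl t ht
    have ht0 : 0 ≤ t :=
      (mul_nonneg (by positivity) (Real.rpow_nonneg (hV0 (z 0)) _)).trans ht
    exact hU.eq_zero_of_scaledLyapunov_eq_zero hβ0 hκ.ne'
      (eq_zero_of_hasDerivAt_le_neg_rpow hκc (fun t => hV0 (z t))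
        (fun s hs => hac _ z hz 0 self_mem_Ici s hs) (hder _ z hz) ht0 ht)

end BasicAssumption

end AbstractSuperTwisting

theorem theorem2 {N : ℕ} (X : Submodule ℝ (EuclideanSpace ℝ (Fin N)))
    (U : X → ℝ) (S : X → Set X) (D : Set X) (cS : ℝ)
    (hA : AbstractSuperTwisting.BasicAssumption U S D cS)
    (L γ k₀ k₁ β : ℝ) (hL : 0 < L) (hγ : 0 ≤ γ) (hk₀ : 0 < k₀) (hk₁ : 0 < k₁) (hβ : 7 ≤ β)
    (hgain₀ : (⨆ x ∈ {x : X × X | AbstractSuperTwisting.homNorm x = 1 ∧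
        0 < AbstractSuperTwisting.Gam U x},
      ((AbstractSuperTwisting.Pie U S D β k₀ k₁ x / AbstractSuperTwisting.Gam U x : ℝ) : EReal))
        < (k₀ : EReal))
    (hgain₁ : 1 / cS < k₁) :
    AbstractSuperTwisting.GloballyFiniteTimeStable
      (AbstractSuperTwisting.superTwisting U S D L γ k₀ k₁) :=
  hA.globallyFiniteTimeStable hL hγ hk₀ hk₁ hβ hgain₀ hgain₁
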